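/- For $\alpha>0$ and $z$ in the upper half-plane $\mathbb{H}=\{z\in\mathbb{C}:\Im z>0\}$ let $$M(\alpha,z)=\sum_{(m,n)\in\mathbb{Z}^2}\frac{|mz+n|^2}{\Im(z)}\,e^{-\pi\alpha\frac{|mz+n|^2}{\Im(z)}}.$$ Let $\mathcal{D}_{\mathcal{G}}=\{z\in\mathbb{H}:|z|>1,\ 0<\Re z<\tfrac12\}$, with closure $\overline{\mathcal{D}_{\mathcal{G}}}$ in $\mathbb{H}$, and let $$\Gamma_a=\{iy: y\ge 1\},\qquad \Gamma_b=\{e^{i\theta}:\theta\in[\tfrac{\pi}{3},\tfrac{\pi}{2}]\},\qquad \Gamma=\Gamma_a\cup\Gamma_b.$$ Then, for every $\alpha\in(0,1]$, the series defining $M(\alpha,z)$ converges for every $z\in\mathbb{H}$, each of the following three minima is attained, and $$\min_{z\in\mathbb{H}}M(\alpha,z)=\min_{z\in\overline{\mathcal{D}_{\mathcal{G}}}}M(\alpha,z)=\min_{z\in\Gamma}M(\alpha,z).$$ -/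

import Mathlib

open UpperHalfPlane

noncomputable section

namespace LatticeEnergy

/-- `|m z + n|² / Im z`: the squared length `|P|²` of the point `P` with coordinates `(m, n)` in the
unit-density lattice `L = (Im z)^(-1/2) (ℤ ⊕ z ℤ)`. -/
def normSqPt (z : ℍ) (p : ℤ × ℤ) : ℝ :=
  ‖(p.1 : ℂ) * (z : ℂ) + (p.2 : ℂ)‖ ^ 2 / z.im

/-- `M(α, z) = ∑_{(m, n) ∈ ℤ²} |P|² exp (-π α |P|²)`. -/
def M (α : ℝ) (z : ℍ) : ℝ :=
  ∑' p : ℤ × ℤ, normSqPt z p * Real.exp (-Real.pi * α * normSqPt z p)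

/-- The open right half `{|z| > 1, 0 < Re z < 1/2}` of the modular fundamental domain. -/
def halfDomain : Set ℍ :=
  {z | 1 < ‖(z : ℂ)‖ ∧ 0 < z.re ∧ z.re < 1 / 2}

/-- The half-line `{i y : y ≥ 1}`. -/
def GammaA : Set ℍ :=
  {z | ∃ y : ℝ, 1 ≤ y ∧ (z : ℂ) = Complex.I * (y : ℂ)}

/-- The arc `{e^{i t} : π/3 ≤ t ≤ π/2}`. -/
def GammaB : Set ℍ :=
  {z | ∃ t ∈ Set.Icc (Real.pi / 3) (Real.pi / 2), (z : ℂ) = Complex.exp (Complex.I * (t : ℂ))}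

/-- `Γ = Γ_a ∪ Γ_b`. -/
def Gamma : Set ℍ := GammaA ∪ GammaB

end LatticeEnergy

end

/-!
Write `z = x + i y`, `A = π α y` and `B = π y / α`, so that `A ≤ B`. Poisson summation in the second
lattice coordinate turns the energy into a cosine series in `x` whose leading nonconstant term is
`-(B - A - 1 / 2) e ^ (-A - B) cos (2 π x)` up to a positive factor. If `B - A` exceeds `1 / 2` by a
margin, the energy on the horizontal line is smallest at `x = 0`, and `i y` or its inverse lies on
`Γ_a`. Otherwise `α` is close to `1`; then the reflected inversion `1 / (1 - z)` has height at most
`√3 / 2`, where the energy is smallest at `x = 1 / 2`, and a second inversion lands on `Γ_b`. High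
points, whose inversions would be too low for the series to be useful, are compared with `i`.

Near `α ≈ 0.91` the leading coefficient changes sign at the height `√3 / 2` of the hexagonal
lattice, and neither estimate applies. There the sign of the second derivative in `x` at the
hexagonal point decides: divided differences of Chebyshev polynomials express every slope of the
energy in `cos (2 π x)` as a perturbation of it, whose error is controlled both above and below that
height. So either points can be moved to the left onto `Γ`, or their reflected inversions can be
moved to `x = 1 / 2`.
-/

namespace LatticeEnergy

open Real

/-! ### Gaussian series and the energy in real coordinates -/

theorem mul_exp_neg_mul_le {a : ℝ} (ha : 0 < a) (s : ℝ) :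
    s * exp (-(a * s)) ≤ 2 / a * exp (-(a / 2 * s)) := by
  have h : a / 2 * s ≤ exp (a / 2 * s) := by linarith [add_one_le_exp (a / 2 * s)]
  calc s * exp (-(a * s)) = 2 / a * (a / 2 * s * exp (-(a * s))) := by field_simp
    _ ≤ 2 / a * (exp (a / 2 * s) * exp (-(a * s))) := by gcongr
    _ = 2 / a * exp (-(a / 2 * s)) := by rw [← exp_add]; ring_nf

section ExponentialSeries

variable {ι : Type*} {s b : ι → ℝ}

theorem summable_mul_exp_neg_mul (hs : ∀ i, 0 ≤ s i)
    (hsum : ∀ t, 0 < t → Summable fun i => exp (-(t * s i))) {t : ℝ} (ht : 0 < t) :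
    Summable fun i => s i * exp (-(t * s i)) :=
  .of_nonneg_of_le (fun i => mul_nonneg (hs i) (exp_pos _).le)
    (fun i => mul_exp_neg_mul_le ht (s i)) ((hsum (t / 2) (half_pos ht)).mul_left _)

theorem summable_mul_of_abs_le_one {f : ι → ℝ} (hf : Summable f) (hf₀ : ∀ i, 0 ≤ f i)
    (hb : ∀ i, |b i| ≤ 1) : Summable fun i => b i * f i :=
  hf.of_norm_bounded fun i => by
    rw [norm_mul, norm_of_nonneg (hf₀ i)]
    exact mul_le_of_le_one_left (hf₀ i) (hb i)

theorem hasDerivAt_tsum_mul_exp_neg_mul (hb : ∀ i, |b i| ≤ 1) (hs : ∀ i, 0 ≤ s i)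
    (hsum : ∀ t, 0 < t → Summable fun i => exp (-(t * s i))) {t : ℝ} (ht : 0 < t) :
    HasDerivAt (fun t => ∑' i, b i * exp (-(t * s i)))
      (-∑' i, b i * (s i * exp (-(t * s i)))) t := by
  have hmem : t ∈ Set.Ioi (t / 2) := half_lt_self ht
  rw [← tsum_neg]
  refine hasDerivAt_tsum_of_isPreconnected (g := fun i t => b i * exp (-(t * s i)))
    (g' := fun i t => -(b i * (s i * exp (-(t * s i)))))
    (summable_mul_exp_neg_mul hs hsum (half_pos ht)) isOpen_Ioi isPreconnected_Ioi
    (fun i u _ => ?_) (fun i u hu => ?_) hmem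
    (summable_mul_of_abs_le_one (hsum t ht) (fun _ => (exp_pos _).le) hb) hmem
  · have := (((hasDerivAt_id u).mul_const (s i)).neg.exp).const_mul (b i)
    exact this.congr_deriv (by simp only [Pi.neg_apply, id]; ring)
  · have hu' : t / 2 ≤ u := le_of_lt hu
    have hsi := hs i
    rw [norm_neg, norm_mul, norm_mul, norm_eq_abs, norm_of_nonneg hsi,
      norm_of_nonneg (exp_pos _).le]
    calc |b i| * (s i * exp (-(u * s i))) ≤ 1 * (s i * exp (-(t / 2 * s i))) := by
          gcongr; exact hb i
      _ = s i * exp (-(t / 2 * s i)) := one_mul _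

end ExponentialSeries

theorem summable_exp_neg_mul_sq_add {a : ℝ} (ha : 0 < a) (ω : ℝ) :
    Summable fun n : ℤ => exp (-(a * ((n : ℝ) + ω) ^ 2)) :=
  (HurwitzZeta.hasSum_int_evenKernel ω (div_pos ha pi_pos)).summable.congr fun n => by
    congr 1; field_simp

theorem summable_exp_neg_mul_sq {a : ℝ} (ha : 0 < a) :
    Summable fun n : ℤ => exp (-(a * (n : ℝ) ^ 2)) := by
  simpa using summable_exp_neg_mul_sq_add ha 0

theorem summable_exp_neg_sq_prod {a b : ℝ} (ha : 0 < a) (hb : 0 < b) :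
    Summable fun p : ℤ × ℤ => exp (-(a * (p.1 : ℝ) ^ 2) - b * (p.2 : ℝ) ^ 2) :=
  ((summable_exp_neg_mul_sq ha).mul_of_nonneg (summable_exp_neg_mul_sq hb)
    (fun _ => (exp_pos _).le) (fun _ => (exp_pos _).le)).congr fun p => by
      rw [← exp_add, sub_eq_add_neg]

/-- The quadratic form `|m z + n|² / Im z` of `normSqPt` in the real coordinates `z = x + i y`. -/
noncomputable def quadForm (x y : ℝ) (p : ℤ × ℤ) : ℝ :=
  ((p.1 * x + p.2) ^ 2 + (p.1 * y) ^ 2) / y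

/-- The lattice energy `M (α, x + i y)` in real coordinates, in which translations and the
inversion act by explicit formulas. -/
noncomputable def energy (α x y : ℝ) : ℝ :=
  ∑' p : ℤ × ℤ, quadForm x y p * exp (-π * α * quadForm x y p)

theorem normSqPt_eq_quadForm (z : ℍ) (p : ℤ × ℤ) : normSqPt z p = quadForm z.re z.im p := by
  rw [normSqPt, quadForm, ← Complex.normSq_eq_norm_sq, Complex.normSq_apply]
  simp [← sq]

theorem M_eq_energy (α : ℝ) (z : ℍ) : M α z = energy α z.re z.im := by
  simp_rw [M, energy, normSqPt_eq_quadForm]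

theorem quadForm_nonneg {y : ℝ} (x : ℝ) (hy : 0 < y) (p : ℤ × ℤ) : 0 ≤ quadForm x y p := by
  unfold quadForm; positivity

theorem exists_pos_mul_sq_add_sq_le_quadForm {y : ℝ} (x : ℝ) (hy : 0 < y) :
    ∃ c > 0, ∀ p : ℤ × ℤ, c * ((p.1 : ℝ) ^ 2 + (p.2 : ℝ) ^ 2) ≤ quadForm x y p := by
  refine ⟨(2 * y + (2 * x ^ 2 + 1) / y)⁻¹, by positivity, fun p => ?_⟩
  have hfst : (p.1 : ℝ) ^ 2 ≤ quadForm x y p / y := by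
    rw [quadForm, div_div, le_div_iff₀ (by positivity)]
    nlinarith [sq_nonneg ((p.1 : ℝ) * x + p.2)]
  have hshift : ((p.1 : ℝ) * x + p.2) ^ 2 ≤ y * quadForm x y p := by
    rw [quadForm, mul_div_cancel₀ _ hy.ne']
    exact le_add_of_nonneg_right (sq_nonneg _)
  have hsnd : (p.2 : ℝ) ^ 2 ≤ 2 * (p.1 * x + p.2) ^ 2 + 2 * x ^ 2 * p.1 ^ 2 := by
    nlinarith [sq_nonneg (2 * (p.1 : ℝ) * x + p.2)]
  rw [inv_mul_le_iff₀ (by positivity)]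
  calc (p.1 : ℝ) ^ 2 + (p.2 : ℝ) ^ 2
      ≤ 2 * (p.1 * x + p.2) ^ 2 + (2 * x ^ 2 + 1) * p.1 ^ 2 := by linarith
    _ ≤ 2 * (y * quadForm x y p) + (2 * x ^ 2 + 1) * (quadForm x y p / y) := by gcongr
    _ = (2 * y + (2 * x ^ 2 + 1) / y) * quadForm x y p := by ring

theorem summable_energy {α y : ℝ} (x : ℝ) (hα : 0 < α) (hy : 0 < y) :
    Summable fun p : ℤ × ℤ => quadForm x y p * exp (-π * α * quadForm x y p) := by
  obtain ⟨c, hc, hle⟩ := exists_pos_mul_sq_add_sq_le_quadForm x hy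
  have hsum (t : ℝ) (ht : 0 < t) : Summable fun p : ℤ × ℤ => exp (-(t * quadForm x y p)) := by
    refine .of_nonneg_of_le (fun p => (exp_pos _).le) (fun p => exp_le_exp.mpr ?_)
      (summable_exp_neg_sq_prod (mul_pos ht hc) (mul_pos ht hc))
    linarith [mul_le_mul_of_nonneg_left (hle p) ht.le]
  simpa [neg_mul] using
    summable_mul_exp_neg_mul (quadForm_nonneg x hy) hsum (mul_pos pi_pos hα)

theorem energy_congr_equiv {x y x' y' : ℝ} (α : ℝ) (e : ℤ × ℤ ≃ ℤ × ℤ)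
    (h : ∀ p, quadForm x y (e p) = quadForm x' y' p) : energy α x y = energy α x' y' := by
  rw [energy, energy, ← e.tsum_eq]
  simp_rw [h]

theorem energy_neg (α x y : ℝ) : energy α (-x) y = energy α x y :=
  energy_congr_equiv α ((Equiv.neg ℤ).prodCongr (Equiv.refl ℤ)) fun p => by simp [quadForm]

theorem energy_abs (α x y : ℝ) : energy α |x| y = energy α x y := by
  rcases abs_choice x with h | h <;> rw [h]
  exact energy_neg α x y

theorem energy_add_one (α x y : ℝ) : energy α (x + 1) y = energy α x y := by
  refine energy_congr_equiv α
    ⟨fun p => (p.1, p.2 - p.1), fun p => (p.1, p.2 + p.1), fun p => by simp, fun p => by simp⟩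
    fun p => ?_
  simp only [quadForm, Equiv.coe_fn_mk, Int.cast_sub]
  ring

theorem energy_one_sub (α x y : ℝ) : energy α (1 - x) y = energy α x y := by
  rw [sub_eq_neg_add, energy_add_one, energy_neg]

theorem energy_inv {y : ℝ} (α x : ℝ) (hy : y ≠ 0) :
    energy α (x / (x ^ 2 + y ^ 2)) (y / (x ^ 2 + y ^ 2)) = energy α x y := by
  refine energy_congr_equiv α (Equiv.prodComm ℤ ℤ) fun p => ?_
  simp only [quadForm, Equiv.prodComm_apply, Prod.fst_swap, Prod.snd_swap]
  field

theorem M_smul (α : ℝ) (g : Matrix.SpecialLinearGroup (Fin 2) ℤ) (z : ℍ) :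
    M α (g • z) = M α z := by
  have hg : g ∈ Subgroup.closure {ModularGroup.S, ModularGroup.T} := by
    simp [SpecialLinearGroup.SL2Z_generators]
  revert z
  induction hg using Subgroup.closure_induction with
  | mem g hg =>
    intro z
    rcases hg with rfl | rfl
    · have hnormSq : Complex.normSq (z : ℂ) = z.re ^ 2 + z.im ^ 2 := by
        simp [Complex.normSq_apply, sq]
      rw [M_eq_energy, M_eq_energy, UpperHalfPlane.modular_S_smul, ← energy_inv α _ z.im_ne_zero,
        ← energy_neg, ← hnormSq]
      congr 1
      · simp [← UpperHalfPlane.coe_re, Complex.inv_re]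
      · simp [← UpperHalfPlane.coe_im, Complex.inv_im, neg_div]
    · rw [M_eq_energy, M_eq_energy, UpperHalfPlane.modular_T_smul, ← energy_add_one α z.re]
      simp [add_comm]
  | one => simp
  | mul g h _ _ hg hh => intro z; rw [mul_smul, hg, hh]
  | inv g _ hg => intro z; rw [← hg, smul_inv_smul]

/-! ### Poisson summation in the second coordinate -/

theorem tsum_exp_neg_sq_add {c : ℝ} (hc : 0 < c) (ω : ℝ) :
    ∑' n : ℤ, exp (-(π * c * ((n : ℝ) + ω) ^ 2)) =
      (√c)⁻¹ * ∑' l : ℤ, cos (2 * π * l * ω) * exp (-(π / c * (l : ℝ) ^ 2)) := by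
  have hcos : HasSum (fun l : ℤ => cos (2 * π * l * ω) * exp (-(π / c * (l : ℝ) ^ 2)))
      (HurwitzZeta.cosKernel ω (1 / c)) := by
    refine (Complex.hasSum_re (HurwitzZeta.hasSum_int_cosKernel ω (one_div_pos.mpr hc))).congr_fun
      fun l => ?_
    rw [Complex.re_mul_ofReal, show 2 * (π : ℂ) * Complex.I * ω * l =
      ((2 * π * l * ω : ℝ) : ℂ) * Complex.I by push_cast; ring, Complex.exp_ofReal_mul_I_re]
    ring_nf
  have heven := HurwitzZeta.evenKernel_functional_equation (ω : UnitAddCircle) c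
  rw [← (HurwitzZeta.hasSum_int_evenKernel ω hc).tsum_eq, ← hcos.tsum_eq, one_div,
    ← sqrt_eq_rpow] at heven
  rw [← heven]
  refine tsum_congr fun n => ?_
  ring_nf

theorem tsum_sq_mul_exp_neg_sq_add {c : ℝ} (hc : 0 < c) (ω : ℝ) :
    ∑' n : ℤ, ((n : ℝ) + ω) ^ 2 * exp (-(π * c * ((n : ℝ) + ω) ^ 2)) =
      (√c)⁻¹ * (1 / (2 * π * c) * (∑' l : ℤ, cos (2 * π * l * ω) * exp (-(π / c * (l : ℝ) ^ 2))) -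
        1 / c ^ 2 *
          ∑' l : ℤ, cos (2 * π * l * ω) * ((l : ℝ) ^ 2 * exp (-(π / c * (l : ℝ) ^ 2)))) := by
  have hleft := (hasDerivAt_tsum_mul_exp_neg_mul (b := fun _ : ℤ => 1) (fun _ => by simp)
    (fun n => sq_nonneg ((n : ℝ) + ω)) (fun t ht => summable_exp_neg_mul_sq_add ht ω)
    (mul_pos pi_pos hc)).comp c ((hasDerivAt_id c).const_mul π)
  have hright := ((hasDerivAt_sqrt hc.ne').inv (by positivity)).mul
    ((hasDerivAt_tsum_mul_exp_neg_mul (fun l : ℤ => abs_cos_le_one (2 * π * l * ω))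
      (fun l : ℤ => sq_nonneg (l : ℝ)) (fun t ht => summable_exp_neg_mul_sq ht)
      (div_pos pi_pos hc)).comp c ((hasDerivAt_inv hc.ne').const_mul π))
  have hderiv := hleft.unique (hright.congr_of_eventuallyEq <| by
    filter_upwards [lt_mem_nhds hc] with d hd
    simpa using tsum_exp_neg_sq_add hd ω)
  simp only [one_mul, Function.comp_apply, Pi.inv_apply, mul_one, sq_sqrt hc.le] at hderiv
  refine mul_right_cancel₀ (neg_ne_zero.mpr pi_pos.ne') ?_
  rw [mul_neg, ← neg_mul, hderiv]
  field

/-- The `(m, l)`-th term, at `x = 0`, of the energy after Poisson summation in the second lattice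
coordinate. -/
noncomputable def kernel (A B : ℝ) (p : ℤ × ℤ) : ℝ :=
  exp (-(A * (p.1 : ℝ) ^ 2) - B * (p.2 : ℝ) ^ 2) * (A * (p.1 : ℝ) ^ 2 + 1 / 2 - B * (p.2 : ℝ) ^ 2)

theorem abs_kernel_le {A B : ℝ} (hA : 0 < A) (hB : 0 < B) (p : ℤ × ℤ) :
    |kernel A B p| ≤ 3 * exp (-(A / 2 * (p.1 : ℝ) ^ 2) - B / 2 * (p.2 : ℝ) ^ 2) := by
  have hm : 0 ≤ A * (p.1 : ℝ) ^ 2 := by positivity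
  have hl : 0 ≤ B * (p.2 : ℝ) ^ 2 := by positivity
  set t := A * (p.1 : ℝ) ^ 2 + B * (p.2 : ℝ) ^ 2 with ht
  have hfactor : |A * (p.1 : ℝ) ^ 2 + 1 / 2 - B * (p.2 : ℝ) ^ 2| ≤ t + 1 := by
    rw [abs_le]; constructor <;> linarith
  have hmul : t * exp (-t) ≤ 2 * exp (-(t / 2)) := by
    have := mul_exp_neg_mul_le one_pos t
    ring_nf at this ⊢
    linarith
  have hexp : exp (-t) ≤ exp (-(t / 2)) := exp_le_exp.mpr (by linarith)
  calc |kernel A B p| = exp (-t) * |A * (p.1 : ℝ) ^ 2 + 1 / 2 - B * (p.2 : ℝ) ^ 2| := by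
        rw [kernel, abs_mul, abs_exp, ht, neg_add']
    _ ≤ exp (-t) * (t + 1) := by gcongr
    _ ≤ 3 * exp (-(t / 2)) := by linarith
    _ = _ := by rw [ht]; ring_nf

theorem summable_abs_kernel {A B : ℝ} (hA : 0 < A) (hB : 0 < B) :
    Summable fun p : ℤ × ℤ => |kernel A B p| :=
  .of_nonneg_of_le (fun _ => abs_nonneg _) (abs_kernel_le hA hB)
    ((summable_exp_neg_sq_prod (half_pos hA) (half_pos hB)).mul_left 3)

theorem summable_kernel_mul_cos {A B : ℝ} (hA : 0 < A) (hB : 0 < B) (x : ℝ) :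
    Summable fun p : ℤ × ℤ => kernel A B p * cos (2 * π * (p.1 * p.2) * x) :=
  (summable_abs_kernel hA hB).of_norm_bounded fun p => by
    rw [norm_mul]
    exact mul_le_of_le_one_right (norm_nonneg _) (abs_cos_le_one _)

theorem quadForm_mul_exp_eq {y : ℝ} (hy : y ≠ 0) (α x : ℝ) (m n : ℤ) :
    quadForm x y (m, n) * exp (-π * α * quadForm x y (m, n)) =
      exp (-(π * α * y * (m : ℝ) ^ 2)) *
        (1 / y * ((n + m * x) ^ 2 * exp (-(π * (α / y) * (n + m * x) ^ 2))) +
          (m : ℝ) ^ 2 * y * exp (-(π * (α / y) * (n + m * x) ^ 2))) := by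
  have hexp : exp (-π * α * quadForm x y (m, n)) =
      exp (-(π * α * y * (m : ℝ) ^ 2)) * exp (-(π * (α / y) * (n + m * x) ^ 2)) := by
    rw [← exp_add, quadForm]
    congr 1
    field
  rw [hexp, quadForm]
  field

theorem tsum_energy_row {α y : ℝ} (hα : 0 < α) (hy : 0 < y) (x : ℝ) (m : ℤ) :
    ∑' n : ℤ, quadForm x y (m, n) * exp (-π * α * quadForm x y (m, n)) =
      √(y / α) / (π * α) *
        ∑' l : ℤ, kernel (π * α * y) (π * y / α) (m, l) * cos (2 * π * (m * l) * x) := by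
  have hc : 0 < α / y := div_pos hα hy
  have hpos : 0 < π * (α / y) := mul_pos pi_pos hc
  have hpos' : 0 < π / (α / y) := div_pos pi_pos hc
  have hkernel (l : ℤ) : kernel (π * α * y) (π * y / α) (m, l) * cos (2 * π * (m * l) * x) =
      exp (-(π * α * y * (m : ℝ) ^ 2)) * ((π * α * y * (m : ℝ) ^ 2 + 1 / 2) *
          (cos (2 * π * l * (m * x)) * exp (-(π / (α / y) * (l : ℝ) ^ 2))) -
        π * y / α *
          (cos (2 * π * l * (m * x)) * ((l : ℝ) ^ 2 * exp (-(π / (α / y) * (l : ℝ) ^ 2))))) := by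
    rw [kernel, sub_eq_add_neg, exp_add, show 2 * π * (m * l) * x = 2 * π * l * (m * x) by ring,
      show π * y / α = π / (α / y) by field]
    ring
  have hgauss := summable_exp_neg_mul_sq_add hpos (m * x)
  have hgauss' := summable_mul_exp_neg_mul (fun n : ℤ => sq_nonneg ((n : ℝ) + m * x))
    (fun t ht => summable_exp_neg_mul_sq_add ht (m * x)) hpos
  have hcos (l : ℤ) : |cos (2 * π * l * (m * x))| ≤ 1 := abs_cos_le_one _
  have hdual := summable_mul_of_abs_le_one (summable_exp_neg_mul_sq hpos')
    (fun l => (exp_pos _).le) hcos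
  have hdual' := summable_mul_of_abs_le_one (summable_mul_exp_neg_mul
    (fun l : ℤ => sq_nonneg (l : ℝ)) (fun t ht => summable_exp_neg_mul_sq ht) hpos')
    (fun l => by positivity) hcos
  have hsqrt : √(y / α) = (√(α / y))⁻¹ := by rw [← sqrt_inv, inv_div]
  simp_rw [quadForm_mul_exp_eq hy.ne', hkernel]
  rw [tsum_mul_left, (hgauss'.mul_left _).tsum_add (hgauss.mul_left _), tsum_mul_left,
    tsum_mul_left, tsum_mul_left, (hdual.mul_left _).tsum_sub (hdual'.mul_left _), tsum_mul_left,
    tsum_mul_left, tsum_exp_neg_sq_add hc, tsum_sq_mul_exp_neg_sq_add hc, hsqrt]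
  field

theorem energy_eq_tsum_kernel {α y : ℝ} (hα : 0 < α) (hy : 0 < y) (x : ℝ) :
    energy α x y = √(y / α) / (π * α) * ∑' p : ℤ × ℤ,
      kernel (π * α * y) (π * y / α) p * cos (2 * π * (p.1 * p.2) * x) := by
  have hA : 0 < π * α * y := by positivity
  have hB : 0 < π * y / α := by positivity
  rw [energy, (summable_energy x hα hy).tsum_prod, (summable_kernel_mul_cos hA hB x).tsum_prod,
    ← tsum_mul_left]
  exact tsum_congr fun m => tsum_energy_row hα hy x m

/-! ### The cosine series of the energy -/

theorem tsum_int_of_even {f : ℤ → ℝ} (hf : f.Even) (hs : Summable f) :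
    ∑' n, f n = f 0 + 2 * ∑' n : ℕ, f (n + 1) := by
  rw [tsum_int_eq_zero_add_two_mul_tsum_pnat hf hs,
    tsum_pnat_eq_tsum_succ (f := fun n : ℕ => f n)]
  simp

theorem injective_natCast_add_one : Function.Injective fun i : ℕ => (i : ℤ) + 1 :=
  fun _ _ h => by simpa using h

theorem tsum_int_prod_of_even {g : ℤ × ℤ → ℝ} (hfst : ∀ m l, g (-m, l) = g (m, l))
    (hsnd : ∀ m l, g (m, -l) = g (m, l)) (hs : Summable g) :
    ∑' p, g p = g (0, 0) + 2 * (∑' j : ℕ, g (0, (j : ℤ) + 1)) +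
      2 * (∑' i : ℕ, g ((i : ℤ) + 1, 0)) +
      4 * ∑' q : ℕ × ℕ, g ((q.1 : ℤ) + 1, (q.2 : ℤ) + 1) := by
  have hrow (m : ℤ) : ∑' l, g (m, l) = g (m, 0) + 2 * ∑' j : ℕ, g (m, (j : ℤ) + 1) :=
    tsum_int_of_even (fun l => hsnd m l) (hs.prod_factor m)
  have hquadrant : Summable fun q : ℕ × ℕ => g ((q.1 : ℤ) + 1, (q.2 : ℤ) + 1) :=
    hs.comp_injective (injective_natCast_add_one.prodMap injective_natCast_add_one)
  have haxis : Summable fun i : ℕ => g ((i : ℤ) + 1, 0) :=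
    hs.comp_injective (i := fun i : ℕ => ((i : ℤ) + 1, (0 : ℤ))) fun _ _ h => by simpa using h
  rw [hs.tsum_prod, tsum_int_of_even (fun m => by simp_rw [hfst]) hs.prod, hquadrant.tsum_prod]
  simp_rw [hrow]
  rw [haxis.tsum_add (hquadrant.prod.mul_left 2), tsum_mul_left]
  ring

/-- The frequency `(i + 1) (j + 1)` of the term of the cosine series with index `(i, j)`. -/
def freq (q : ℕ × ℕ) : ℕ := (q.1 + 1) * (q.2 + 1)

/-- The Gaussian weight on the index set of the cosine series, normalised to be `1` at `(0, 0)`. -/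
noncomputable def weight (P Q : ℝ) (q : ℕ × ℕ) : ℝ :=
  exp (-(P * (((q.1 : ℝ) + 1) ^ 2 - 1)) - Q * (((q.2 : ℝ) + 1) ^ 2 - 1))

/-- Minus the coefficient of `4 cos (2 π (i + 1) (j + 1) x)` in the cosine series of the energy,
divided by the Gaussian factor `exp (-A - B)` of the leading term. -/
noncomputable def coeff (A B : ℝ) (q : ℕ × ℕ) : ℝ :=
  weight A B q * (B * ((q.2 : ℝ) + 1) ^ 2 - A * ((q.1 : ℝ) + 1) ^ 2 - 1 / 2)

theorem freq_cast (q : ℕ × ℕ) : (freq q : ℝ) = ((q.1 : ℝ) + 1) * ((q.2 : ℝ) + 1) := by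
  simp [freq]

theorem kernel_succ (A B : ℝ) (q : ℕ × ℕ) :
    kernel A B ((q.1 : ℤ) + 1, (q.2 : ℤ) + 1) = -(exp (-A - B) * coeff A B q) := by
  rw [kernel, coeff, weight, ← mul_assoc, ← exp_add, ← mul_neg]
  push_cast
  ring_nf

theorem summable_coeff {A B : ℝ} (hA : 0 < A) (hB : 0 < B) :
    Summable fun q : ℕ × ℕ => |coeff A B q| := by
  have hquadrant := ((summable_abs_kernel hA hB).comp_injective
    (injective_natCast_add_one.prodMap injective_natCast_add_one)).mul_left (exp (A + B))
  refine hquadrant.congr fun q => ?_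
  simp only [Function.comp, Prod.map]
  rw [kernel_succ, abs_neg, abs_mul, abs_exp, ← mul_assoc, ← exp_add]
  simp [add_assoc]

theorem summable_coeff_mul_of_bounded {A B C : ℝ} (hA : 0 < A) (hB : 0 < B) {u : ℕ × ℕ → ℝ}
    (hu : ∀ q, |u q| ≤ C) : Summable fun q => coeff A B q * u q :=
  ((summable_coeff hA hB).mul_right C).of_norm_bounded fun q => by
    rw [norm_mul]
    exact mul_le_mul_of_nonneg_left (hu q) (norm_nonneg _)

theorem tsum_kernel_eq {A B : ℝ} (hA : 0 < A) (hB : 0 < B) (x : ℝ) :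
    ∑' p : ℤ × ℤ, kernel A B p * cos (2 * π * (p.1 * p.2) * x) =
      1 / 2 + 2 * (∑' j : ℕ, kernel A B (0, (j : ℤ) + 1)) +
        2 * (∑' i : ℕ, kernel A B ((i : ℤ) + 1, 0)) -
        4 * exp (-A - B) * ∑' q : ℕ × ℕ, coeff A B q * cos (2 * π * freq q * x) := by
  have hquadrant (q : ℕ × ℕ) : kernel A B ((q.1 : ℤ) + 1, (q.2 : ℤ) + 1) *
      cos (2 * π * ((((q.1 : ℤ) + 1 : ℤ) : ℝ) * (((q.2 : ℤ) + 1 : ℤ) : ℝ)) * x) =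
      -exp (-A - B) * (coeff A B q * cos (2 * π * freq q * x)) := by
    rw [kernel_succ, freq_cast]
    push_cast
    ring
  have hzero : kernel A B (0, 0) = 1 / 2 := by simp [kernel]
  rw [tsum_int_prod_of_even (fun m l => ?_) (fun m l => ?_) (summable_kernel_mul_cos hA hB x)]
  · simp_rw [hquadrant]
    rw [tsum_mul_left]
    simp [hzero]
    ring
  · simp only [kernel, Int.cast_neg, neg_sq]
    rw [show 2 * π * (-(m : ℝ) * l) * x = -(2 * π * (m * l) * x) by ring, cos_neg]
  · simp only [kernel, Int.cast_neg, neg_sq]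
    rw [show 2 * π * ((m : ℝ) * -l) * x = -(2 * π * (m * l) * x) by ring, cos_neg]

theorem exists_pos_energy_sub_energy {α y : ℝ} (hα : 0 < α) (hy : 0 < y) (x x' : ℝ) :
    ∃ C > 0, energy α x y - energy α x' y = C * ∑' q : ℕ × ℕ,
      coeff (π * α * y) (π * y / α) q *
        (cos (2 * π * freq q * x') - cos (2 * π * freq q * x)) := by
  have hA : 0 < π * α * y := by positivity
  have hB : 0 < π * y / α := by positivity
  have hs (x : ℝ) : Summable fun q : ℕ × ℕ =>
      coeff (π * α * y) (π * y / α) q * cos (2 * π * freq q * x) :=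
    summable_coeff_mul_of_bounded hA hB fun q => abs_cos_le_one _
  refine ⟨√(y / α) / (π * α) * (4 * exp (-(π * α * y) - π * y / α)), by positivity, ?_⟩
  rw [energy_eq_tsum_kernel hα hy, energy_eq_tsum_kernel hα hy, tsum_kernel_eq hA hB,
    tsum_kernel_eq hA hB]
  simp_rw [mul_sub]
  rw [(hs x').tsum_sub (hs x)]
  ring

/-! ### Divided differences of Chebyshev polynomials -/

theorem abs_sin_nat_mul_le (k : ℕ) (s : ℝ) : |sin (k * s)| ≤ k * |sin s| := by
  induction k with
  | zero => simp
  | succ k ih =>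
    push_cast
    rw [add_mul, one_mul, sin_add]
    calc _ ≤ |sin (k * s) * cos s| + |cos (k * s) * sin s| := abs_add_le _ _
      _ ≤ |sin (k * s)| * 1 + 1 * |sin s| := by
        rw [abs_mul, abs_mul]; gcongr <;> exact abs_cos_le_one _
      _ ≤ (k + 1) * |sin s| := by linarith

theorem abs_cos_nat_mul_sub_le (k : ℕ) (a b : ℝ) :
    |cos (k * a) - cos (k * b)| ≤ k ^ 2 * |cos a - cos b| := by
  rw [cos_sub_cos, cos_sub_cos, ← mul_add, ← mul_sub, mul_div_assoc, mul_div_assoc, abs_mul,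
    abs_mul, abs_mul, abs_mul]
  calc _ ≤ |(-2 : ℝ)| * (k * |sin ((a + b) / 2)|) * (k * |sin ((a - b) / 2)|) := by
        gcongr <;> exact abs_sin_nat_mul_le k _
    _ = _ := by ring

theorem one_sub_cos_nat_mul_le (k : ℕ) (a : ℝ) : 1 - cos (k * a) ≤ k ^ 2 * (1 - cos a) := by
  simpa [abs_of_nonneg (sub_nonneg.mpr (cos_le_one _))] using abs_cos_nat_mul_sub_le k 0 a

/-- The divided difference of the `k`-th Chebyshev polynomial at `cos a` and `cos b`; it takes the
junk value `0` when `cos a = cos b`. -/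
noncomputable def chebDiff (k : ℕ) (a b : ℝ) : ℝ :=
  (cos (k * a) - cos (k * b)) / (cos a - cos b)

theorem sub_mul_chebDiff (k : ℕ) (a b : ℝ) :
    (cos a - cos b) * chebDiff k a b = cos (k * a) - cos (k * b) := by
  refine mul_div_cancel_of_imp' fun h => abs_nonpos_iff.mp ?_
  simpa [h] using abs_cos_nat_mul_sub_le k a b

theorem abs_chebDiff_le (k : ℕ) (a b : ℝ) : |chebDiff k a b| ≤ k ^ 2 := by
  rw [chebDiff, abs_div]
  exact div_le_of_le_mul₀ (abs_nonneg _) (by positivity) (abs_cos_nat_mul_sub_le k a b)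

theorem chebDiff_zero (a b : ℝ) : chebDiff 0 a b = 0 := by simp [chebDiff]

theorem chebDiff_one {a b : ℝ} (h : cos a ≠ cos b) : chebDiff 1 a b = 1 := by
  simp [chebDiff, div_self (sub_ne_zero.mpr h)]

theorem chebDiff_add_two (k : ℕ) {a b : ℝ} (h : cos a ≠ cos b) :
    chebDiff (k + 2) a b =
      2 * cos b * chebDiff (k + 1) a b + 2 * cos ((k + 1 : ℕ) * a) - chebDiff k a b := by
  have hcos (t : ℝ) : cos ((k + 2 : ℕ) * t) = 2 * cos t * cos ((k + 1 : ℕ) * t) - cos (k * t) := by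
    have hadd : ((k + 2 : ℕ) : ℝ) * t = (k + 1 : ℕ) * t + t := by push_cast; ring
    have hsub : (k : ℝ) * t = (k + 1 : ℕ) * t - t := by push_cast; ring
    rw [hadd, hsub, cos_add, cos_sub]
    ring
  have : cos a - cos b ≠ 0 := sub_ne_zero.mpr h
  rw [chebDiff, chebDiff, chebDiff, hcos, hcos]
  field

theorem chebDiff_two {a b : ℝ} (h : cos a ≠ cos b) : chebDiff 2 a b = 2 * (cos a + cos b) := by
  have := chebDiff_add_two 0 h
  rw [zero_add, zero_add, chebDiff_one h, chebDiff_zero] at this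
  rw [this, Nat.cast_one, one_mul]
  ring

/-- The increments of the left-hand side obey the Chebyshev recurrence up to errors controlled by
`one_sub_cos_nat_mul_le` and `abs_chebDiff_le`. -/
theorem sq_sub_chebDiff_succ_sub_le {a b : ℝ} (h : cos a ≠ cos b) (k : ℕ) :
    ((k + 1 : ℝ) ^ 2 - chebDiff (k + 1) a b) - ((k : ℝ) ^ 2 - chebDiff k a b) ≤
      k * (k + 1) * (2 * k + 1) / 3 * (2 - cos a - cos b) := by
  induction k with
  | zero => simp [chebDiff_one h, chebDiff_zero]
  | succ k ih =>
    have hcos := one_sub_cos_nat_mul_le (k + 1) a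
    have hdiff := mul_le_mul_of_nonneg_left (le_of_abs_le (abs_chebDiff_le (k + 1) a b))
      (sub_nonneg.mpr (cos_le_one b))
    rw [chebDiff_add_two k h]
    push_cast at hcos hdiff ⊢
    nlinarith

theorem sq_sub_chebDiff_le {a b : ℝ} (h : cos a ≠ cos b) (k : ℕ) :
    (k : ℝ) ^ 2 - chebDiff k a b ≤ k ^ 4 / 6 * (2 - cos a - cos b) := by
  have hsharp : (k : ℝ) ^ 2 - chebDiff k a b ≤ k ^ 2 * (k ^ 2 - 1) / 6 * (2 - cos a - cos b) := by
    induction k with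
    | zero => simp [chebDiff_zero]
    | succ k ih =>
      have := sq_sub_chebDiff_succ_sub_le h k
      push_cast
      linarith
  refine hsharp.trans (mul_le_mul_of_nonneg_right ?_ (by linarith [cos_le_one a, cos_le_one b]))
  nlinarith [sq_nonneg (k : ℝ)]

/-! ### Bounds for Gaussian sums -/

theorem exp_neg_le {x t c : ℝ} (n : ℕ) (hx : 0 ≤ x) (hc : 0 ≤ c) (ht : x ≤ t)
    (h : 1 ≤ c * ∑ i ∈ Finset.range n, x ^ i / i.factorial) : exp (-t) ≤ c := by
  rw [exp_neg, inv_le_iff_one_le_mul₀ (exp_pos t)]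
  refine h.trans ?_
  gcongr
  exact (sum_le_exp_of_nonneg hx n).trans (exp_le_exp.mpr ht)

/-- The Gaussian weight `r ^ n exp (-P (r ^ 2 - 1))`, normalised to be `1` at `r = 1`. -/
noncomputable def gaussWeight (P : ℝ) (n : ℕ) (r : ℝ) : ℝ := r ^ n * exp (-(P * (r ^ 2 - 1)))

/-- An upper bound for the sum of `gaussWeight P n r` over the integers `r ≥ 3`. -/
noncomputable def gaussTail (P : ℝ) (n : ℕ) : ℝ := 501 / 500 * 3 ^ n * exp (-(8 * P))

theorem gaussWeight_nonneg (P : ℝ) (n : ℕ) {r : ℝ} (hr : 0 ≤ r) : 0 ≤ gaussWeight P n r := by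
  rw [gaussWeight]; positivity

theorem gaussTail_pos (P : ℝ) (n : ℕ) : 0 < gaussTail P n := by
  rw [gaussTail]; positivity

theorem natCast_add_three_pow_le {n : ℕ} (hn : n ≤ 6) (i : ℕ) :
    ((i : ℝ) + 3) ^ n ≤ 3 ^ n * 6 ^ i := by
  have hsix : (1 + (i : ℝ) / 3) ^ 6 ≤ 6 ^ i := by
    induction i with
    | zero => simp
    | succ i ih =>
      rcases Nat.eq_zero_or_pos i with rfl | hi
      · norm_num
      · have : (1 : ℝ) ≤ i := by exact_mod_cast hi
        calc (1 + ((i + 1 : ℕ) : ℝ) / 3) ^ 6 ≤ (5 / 4 * (1 + (i : ℝ) / 3)) ^ 6 := by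
              gcongr; push_cast; linarith
          _ = (5 / 4) ^ 6 * (1 + (i : ℝ) / 3) ^ 6 := mul_pow ..
          _ ≤ 6 * 6 ^ i := by gcongr; norm_num
          _ = 6 ^ (i + 1) := (pow_succ' 6 i).symm
  have hone : 1 ≤ 1 + (i : ℝ) / 3 := le_add_of_nonneg_right (by positivity)
  calc ((i : ℝ) + 3) ^ n = 3 ^ n * (1 + (i : ℝ) / 3) ^ n := by rw [← mul_pow]; ring
    _ ≤ 3 ^ n * 6 ^ i := by gcongr; exact (pow_le_pow_right₀ hone hn).trans hsix

theorem gaussWeight_add_three_le {P : ℝ} (hP : 6 / 5 ≤ P) {n : ℕ} (hn : n ≤ 6) (i : ℕ) :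
    gaussWeight P n (i + 3) ≤ 3 ^ n * exp (-(8 * P)) * (1 / 600 : ℝ) ^ i := by
  have hratio : exp (-(7 * P)) ≤ 1 / 3600 := exp_neg_le (x := 42 / 5) 14 (by norm_num)
    (by norm_num) (by linarith) (by norm_num [Finset.sum_range_succ, Nat.factorial])
  have hexp : exp (-(P * (((i : ℝ) + 3) ^ 2 - 1))) ≤ exp (-(8 * P)) * (1 / 3600 : ℝ) ^ i :=
    calc exp (-(P * (((i : ℝ) + 3) ^ 2 - 1))) ≤ exp (-(8 * P) + i * -(7 * P)) := by
          have : (i : ℝ) ≤ (i : ℝ) ^ 2 := by exact_mod_cast Nat.le_self_pow two_ne_zero i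
          gcongr
          nlinarith
      _ = exp (-(8 * P)) * exp (-(7 * P)) ^ i := by rw [exp_add, exp_nat_mul]
      _ ≤ exp (-(8 * P)) * (1 / 3600 : ℝ) ^ i := by gcongr
  calc gaussWeight P n (i + 3) ≤ (3 ^ n * 6 ^ i) * (exp (-(8 * P)) * (1 / 3600 : ℝ) ^ i) :=
        mul_le_mul (natCast_add_three_pow_le hn i) hexp (exp_nonneg _) (by positivity)
    _ = 3 ^ n * exp (-(8 * P)) * (6 * (1 / 3600) : ℝ) ^ i := by rw [mul_pow]; ring
    _ = 3 ^ n * exp (-(8 * P)) * (1 / 600 : ℝ) ^ i := by norm_num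

theorem summable_gaussWeight_add_three {P : ℝ} (hP : 6 / 5 ≤ P) {n : ℕ} (hn : n ≤ 6) :
    Summable fun i : ℕ => gaussWeight P n (i + 3) :=
  Summable.of_nonneg_of_le (fun _ => gaussWeight_nonneg P n (by positivity))
    (gaussWeight_add_three_le hP hn)
    ((summable_geometric_of_lt_one (by norm_num) (by norm_num)).mul_left _)

theorem tsum_gaussWeight_add_three_le {P : ℝ} (hP : 6 / 5 ≤ P) {n : ℕ} (hn : n ≤ 6) :
    ∑' i : ℕ, gaussWeight P n (i + 3) ≤ gaussTail P n := by
  have hgeom := summable_geometric_of_lt_one (r := (1 / 600 : ℝ)) (by norm_num) (by norm_num)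
  refine ((summable_gaussWeight_add_three hP hn).tsum_le_tsum (gaussWeight_add_three_le hP hn)
    (hgeom.mul_left _)).trans ?_
  rw [tsum_mul_left, tsum_geometric_of_lt_one (by norm_num) (by norm_num), gaussTail]
  have : 0 < 3 ^ n * exp (-(8 * P)) := by positivity
  linarith

theorem summable_gaussWeight_add_two {P : ℝ} (hP : 6 / 5 ≤ P) {n : ℕ} (hn : n ≤ 6) :
    Summable fun i : ℕ => gaussWeight P n (i + 2) := by
  rw [← summable_nat_add_iff 1]
  refine (summable_gaussWeight_add_three hP hn).congr fun i => ?_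
  push_cast
  ring_nf

theorem tsum_gaussWeight_add_two_le {P : ℝ} (hP : 6 / 5 ≤ P) {n : ℕ} (hn : n ≤ 6) :
    ∑' i : ℕ, gaussWeight P n (i + 2) ≤ 2 ^ n * exp (-(3 * P)) + gaussTail P n := by
  have htail (i : ℕ) : gaussWeight P n ((i + 1 : ℕ) + 2) = gaussWeight P n (i + 3) := by
    push_cast
    ring_nf
  have hzero : gaussWeight P n ((0 : ℕ) + 2) = 2 ^ n * exp (-(3 * P)) := by
    norm_num [gaussWeight, mul_comm P]
  rw [(summable_gaussWeight_add_two hP hn).tsum_eq_zero_add, hzero]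
  simp_rw [htail]
  gcongr
  exact tsum_gaussWeight_add_three_le hP hn

theorem summable_gaussWeight_add_one {P : ℝ} (hP : 6 / 5 ≤ P) {n : ℕ} (hn : n ≤ 6) :
    Summable fun i : ℕ => gaussWeight P n (i + 1) := by
  rw [← summable_nat_add_iff 1]
  refine (summable_gaussWeight_add_two hP hn).congr fun i => ?_
  push_cast
  ring_nf

theorem freq_pow_mul_weight (P Q : ℝ) (n : ℕ) (q : ℕ × ℕ) :
    freq q ^ n * weight P Q q = gaussWeight P n (q.1 + 1) * gaussWeight Q n (q.2 + 1) := by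
  rw [freq_cast, weight, gaussWeight, gaussWeight, sub_eq_add_neg (-_), exp_add, mul_pow]
  ring

theorem summable_of_abs_le_freq_pow_mul_weight {P Q C : ℝ} (hP : 6 / 5 ≤ P) (hQ : 6 / 5 ≤ Q)
    {n : ℕ} (hn : n ≤ 6) {a : ℕ × ℕ → ℝ} (ha : ∀ q, |a q| ≤ C * (freq q ^ n * weight P Q q)) :
    Summable a := by
  simp_rw [freq_pow_mul_weight] at ha
  exact (((summable_gaussWeight_add_one hP hn).mul_of_nonneg (summable_gaussWeight_add_one hQ hn)
    (fun _ => gaussWeight_nonneg P n (by positivity))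
    (fun _ => gaussWeight_nonneg Q n (by positivity))).mul_left C).of_norm_bounded ha

theorem tsum_prod_eq_leading_add {a : ℕ × ℕ → ℝ} (ha : Summable a) :
    ∑' q, a q = a (0, 0) + (a (1, 0) + a (0, 1)) + (∑' i, a (i + 2, 0) + ∑' j, a (0, j + 2) +
      ∑' q : ℕ × ℕ, a (q.1 + 1, q.2 + 1)) := by
  have hcol : Summable fun i : ℕ => a (i + 1, 0) :=
    ha.comp_injective (i := fun i : ℕ => (i + 1, 0)) fun _ _ h => by simpa using h
  have hrow : Summable fun j : ℕ => a (0, j) := ha.prod_factor 0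
  have hquadrant : Summable fun q : ℕ × ℕ => a (q.1 + 1, q.2 + 1) :=
    ha.comp_injective ((add_left_injective 1).prodMap (add_left_injective 1))
  have hrows (i : ℕ) : ∑' j, a (i + 1, j) = a (i + 1, 0) + ∑' j, a (i + 1, j + 1) :=
    (ha.prod_factor (i + 1)).tsum_eq_zero_add
  rw [ha.tsum_prod, ha.prod.tsum_eq_zero_add, hquadrant.tsum_prod]
  simp_rw [hrows]
  rw [hcol.tsum_add hquadrant.prod, hcol.tsum_eq_zero_add, hrow.tsum_eq_zero_add,
    ((summable_nat_add_iff 1).mpr hrow).tsum_eq_zero_add]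
  ring

theorem abs_tsum_le_mul_gaussTail {P C : ℝ} (hP : 6 / 5 ≤ P) {n : ℕ} (hn : n ≤ 6) (hC : 0 ≤ C)
    {a : ℕ → ℝ} (ha : ∀ i : ℕ, |a i| ≤ C * gaussWeight P n (i + 3)) :
    |∑' i, a i| ≤ C * gaussTail P n := by
  refine (tsum_of_norm_bounded (f := a)
    ((summable_gaussWeight_add_three hP hn).mul_left C).hasSum ha).trans ?_
  rw [tsum_mul_left]
  gcongr
  exact tsum_gaussWeight_add_three_le hP hn

theorem abs_tsum_prod_le {P Q D : ℝ} (hP : 6 / 5 ≤ P) (hQ : 6 / 5 ≤ Q) {n : ℕ} (hn : n ≤ 6)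
    (hD : 0 ≤ D) {a : ℕ × ℕ → ℝ}
    (ha : ∀ q, |a q| ≤ D * (gaussWeight P n (q.1 + 2) * gaussWeight Q n (q.2 + 2))) :
    |∑' q, a q| ≤ D * ((2 ^ n * exp (-(3 * P)) + gaussTail P n) *
      (2 ^ n * exp (-(3 * Q)) + gaussTail Q n)) := by
  have hPnn (i : ℕ) : 0 ≤ gaussWeight P n (i + 2) := gaussWeight_nonneg P n (by positivity)
  have hQnn (i : ℕ) : 0 ≤ gaussWeight Q n (i + 2) := gaussWeight_nonneg Q n (by positivity)
  have hPs := summable_gaussWeight_add_two hP hn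
  have hQs := summable_gaussWeight_add_two hQ hn
  have hPQ := hPs.mul_of_nonneg hQs hPnn hQnn
  refine (tsum_of_norm_bounded (f := a) (hPQ.mul_left D).hasSum ha).trans ?_
  rw [tsum_mul_left, ← hPs.tsum_mul_tsum hQs hPQ]
  have : 0 ≤ ∑' i : ℕ, gaussWeight Q n (i + 2) := tsum_nonneg hQnn
  have := gaussTail_pos P n
  gcongr
  exacts [tsum_gaussWeight_add_two_le hP hn, tsum_gaussWeight_add_two_le hQ hn]

theorem abs_tsum_sub_leading_le {P Q C D : ℝ} (hP : 6 / 5 ≤ P) (hQ : 6 / 5 ≤ Q) {n : ℕ}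
    (hn : n ≤ 6) (hC : 0 ≤ C) (hD : 0 ≤ D) {a : ℕ × ℕ → ℝ}
    (ha : ∀ q, |a q| ≤ C * (freq q ^ n * weight P Q q))
    (ha' : ∀ i j, |a (i + 1, j + 1)| ≤ D * (freq (i + 1, j + 1) ^ n * weight P Q (i + 1, j + 1))) :
    |∑' q, a q - (a (0, 0) + (a (1, 0) + a (0, 1)))| ≤ C * (gaussTail P n + gaussTail Q n) +
      D * ((2 ^ n * exp (-(3 * P)) + gaussTail P n) *
        (2 ^ n * exp (-(3 * Q)) + gaussTail Q n)) := by
  have hsum := summable_of_abs_le_freq_pow_mul_weight hP hQ hn ha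
  simp_rw [freq_pow_mul_weight] at ha ha'
  have hone (R : ℝ) : gaussWeight R n 1 = 1 := by simp [gaussWeight]
  have hcol : |∑' i, a (i + 2, 0)| ≤ C * gaussTail P n :=
    abs_tsum_le_mul_gaussTail hP hn hC fun i => (ha _).trans_eq (by
      push_cast; rw [zero_add, hone]; ring_nf)
  have hrow : |∑' j, a (0, j + 2)| ≤ C * gaussTail Q n :=
    abs_tsum_le_mul_gaussTail hQ hn hC fun j => (ha _).trans_eq (by
      push_cast; rw [zero_add, hone]; ring_nf)
  have hquadrant := abs_tsum_prod_le (a := fun q => a (q.1 + 1, q.2 + 1)) hP hQ hn hD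
    fun q => (ha' q.1 q.2).trans_eq (by push_cast; ring_nf)
  rw [tsum_prod_eq_leading_add hsum, add_sub_cancel_left]
  linarith [abs_add_three (∑' i, a (i + 2, 0)) (∑' j, a (0, j + 2))
    (∑' q : ℕ × ℕ, a (q.1 + 1, q.2 + 1))]

/-! ### Slopes of the energy along horizontal lines -/

/-- The alternating double series `∑ (-1) ^ (k + 1) τ k * coeff`, `k = (i + 1) (j + 1)`. -/
noncomputable def harmonicSum (A B : ℝ) (τ : ℕ → ℝ) : ℝ :=
  ∑' q : ℕ × ℕ, coeff A B q * ((-1) ^ (freq q + 1) * τ (freq q))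

/-- Up to a positive factor, the difference quotient of the energy with respect to
`-cos (2 π x)` between the abscissae `1 / 2 - a / (2 π)` and `1 / 2 - b / (2 π)`. -/
noncomputable def slope (A B a b : ℝ) : ℝ := harmonicSum A B fun k => chebDiff k a b

/-- The total coefficient of `τ 2` in `harmonicSum A B τ`. -/
noncomputable def secondCoeff (A B : ℝ) : ℝ :=
  exp (-(3 * A)) * (4 * A + 1 / 2 - B) - exp (-(3 * B)) * (4 * B - A - 1 / 2)

theorem exists_pos_energy_half_sub {α y : ℝ} (hα : 0 < α) (hy : 0 < y) (q q' : ℝ) :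
    ∃ C > 0, energy α (1 / 2 - q) y - energy α (1 / 2 - q') y =
      C * ((cos (2 * π * q) - cos (2 * π * q')) *
        slope (π * α * y) (π * y / α) (2 * π * q) (2 * π * q')) := by
  obtain ⟨C, hC, hsub⟩ := exists_pos_energy_sub_energy hα hy (1 / 2 - q) (1 / 2 - q')
  refine ⟨C, hC, ?_⟩
  rw [hsub, slope, harmonicSum]
  congr 1
  rw [← tsum_mul_left]
  refine tsum_congr fun p => ?_
  have hcos (t : ℝ) : cos (2 * π * freq p * (1 / 2 - t)) =
      (-1) ^ freq p * cos (freq p * (2 * π * t)) := by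
    rw [← cos_nat_mul_pi_sub]; ring_nf
  rw [hcos, hcos]
  linear_combination (-1) ^ freq p * coeff (π * α * y) (π * y / α) p *
    sub_mul_chebDiff (freq p) (2 * π * q) (2 * π * q')

theorem coeff_zero_zero (A B : ℝ) : coeff A B (0, 0) = B - A - 1 / 2 := by simp [coeff, weight]

theorem coeff_one_zero_add_coeff_zero_one (A B : ℝ) :
    coeff A B (1, 0) + coeff A B (0, 1) = -secondCoeff A B := by
  simp only [coeff, weight, secondCoeff]
  push_cast
  ring_nf

theorem weight_le_weight {P P' Q Q' : ℝ} (hP : P ≤ P') (hQ : Q ≤ Q') (q : ℕ × ℕ) :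
    weight P' Q' q ≤ weight P Q q := by
  have hsq (i : ℕ) : 0 ≤ ((i : ℝ) + 1) ^ 2 - 1 :=
    sub_nonneg.mpr (one_le_pow₀ (le_add_of_nonneg_left i.cast_nonneg))
  rw [weight, weight]
  refine exp_le_exp.mpr ?_
  linarith [mul_le_mul_of_nonneg_right hP (hsq q.1), mul_le_mul_of_nonneg_right hQ (hsq q.2)]

theorem abs_coeff_mul_sign_le {A B C : ℝ} (hAB : A ≤ B) {τ : ℕ → ℝ}
    (hτ : ∀ k, |τ k| ≤ (k : ℝ) ^ 2) {q : ℕ × ℕ}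
    (hC : |B * ((q.2 : ℝ) + 1) ^ 2 - A * ((q.1 : ℝ) + 1) ^ 2 - 1 / 2| ≤ C * freq q ^ 2) :
    |coeff A B q * ((-1) ^ (freq q + 1) * τ (freq q))| ≤ C * (freq q ^ 4 * weight A A q) := by
  have hw (R : ℝ) : 0 ≤ weight A R q := exp_nonneg _
  rw [abs_mul, abs_mul, abs_pow, abs_neg, abs_one, one_pow, one_mul, coeff, abs_mul,
    abs_of_nonneg (hw B)]
  calc _ ≤ weight A A q * (C * freq q ^ 2) * freq q ^ 2 := by
        have := hw A
        have := (abs_nonneg _).trans hC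
        gcongr
        exacts [weight_le_weight le_rfl hAB q, hτ _]
    _ = _ := by ring

theorem abs_sub_sub_half_le {A B m l : ℝ} (hA : 1 ≤ A) (hAB : A ≤ B) (hm : 1 ≤ m) (hl : 1 ≤ l) :
    |B * l - A * m - 1 / 2| ≤ B * (m * l) := by
  have hlow : 0 ≤ B * (m * (l - 1) + l - 1) := by
    have := mul_nonneg (zero_le_one.trans hm) (sub_nonneg.mpr hl)
    exact mul_nonneg (by linarith) (by linarith)
  have hup : 0 ≤ B * l * (m - 1) :=
    mul_nonneg (mul_nonneg (by linarith) (by linarith)) (by linarith)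
  have hAm : 0 ≤ A * m := mul_nonneg (by linarith) (by linarith)
  have hABm := mul_le_mul_of_nonneg_right hAB (zero_le_one.trans hm)
  rw [abs_le]
  constructor <;> linarith

theorem abs_sub_sub_half_le_quarter {A B m l : ℝ} (hA : 1 ≤ A) (hAB : A ≤ B) (hm : 4 ≤ m)
    (hl : 4 ≤ l) : |B * l - A * m - 1 / 2| ≤ B / 4 * (m * l) := by
  have hBl : 0 ≤ B * l * (m - 4) :=
    mul_nonneg (mul_nonneg (by linarith) (by linarith)) (by linarith)
  have hBm : 0 ≤ B * m * (l - 4) :=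
    mul_nonneg (mul_nonneg (by linarith) (by linarith)) (by linarith)
  have hAm : 0 ≤ A * m := mul_nonneg (by linarith) (by linarith)
  have hABm := mul_le_mul_of_nonneg_right hAB (by linarith : 0 ≤ m)
  have hl' : 4 ≤ B * l := by nlinarith
  rw [abs_le]
  constructor <;> linarith

theorem abs_coeff_mul_sign_le_of_one_le {A B : ℝ} (hA : 1 ≤ A) (hAB : A ≤ B) {τ : ℕ → ℝ}
    (hτ : ∀ k, |τ k| ≤ (k : ℝ) ^ 2) (q : ℕ × ℕ) :
    |coeff A B q * ((-1) ^ (freq q + 1) * τ (freq q))| ≤ B * (freq q ^ 4 * weight A A q) := by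
  have hsucc (i : ℕ) : (1 : ℝ) ≤ (i + 1) ^ 2 := one_le_pow₀ (le_add_of_nonneg_left i.cast_nonneg)
  refine abs_coeff_mul_sign_le hAB hτ ?_
  rw [freq_cast, mul_pow]
  exact abs_sub_sub_half_le hA hAB (hsucc q.1) (hsucc q.2)

theorem summable_coeff_mul_sign {A B : ℝ} (hA : 6 / 5 ≤ A) (hAB : A ≤ B) {τ : ℕ → ℝ}
    (hτ : ∀ k, |τ k| ≤ (k : ℝ) ^ 2) :
    Summable fun q => coeff A B q * ((-1) ^ (freq q + 1) * τ (freq q)) :=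
  summable_of_abs_le_freq_pow_mul_weight hA hA (n := 4) (by norm_num)
    (abs_coeff_mul_sign_le_of_one_le (by linarith) hAB hτ)

theorem abs_harmonicSum_sub_le {A B : ℝ} (hA : 6 / 5 ≤ A) (hAB : A ≤ B) {τ : ℕ → ℝ}
    (hτ : ∀ k, |τ k| ≤ (k : ℝ) ^ 2) :
    |harmonicSum A B τ - ((B - A - 1 / 2) * τ 1 + secondCoeff A B * τ 2)| ≤
      B * (2 * gaussTail A 4 + 1 / 4 * (2 ^ 4 * exp (-(3 * A)) + gaussTail A 4) ^ 2) := by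
  have htwo (i : ℕ) : (4 : ℝ) ≤ ((i + 1 : ℕ) + 1) ^ 2 := by
    push_cast
    nlinarith [i.cast_nonneg (α := ℝ)]
  have hmain := abs_tsum_sub_leading_le (C := B) (D := B / 4) hA hA (n := 4) (by norm_num)
    (by linarith) (by linarith)
    (abs_coeff_mul_sign_le_of_one_le (by linarith) hAB hτ)
    (fun i j => abs_coeff_mul_sign_le hAB hτ (by
      rw [freq_cast, mul_pow]
      exact abs_sub_sub_half_le_quarter (by linarith) hAB (htwo i) (htwo j)))
  rw [coeff_zero_zero] at hmain
  calc _ = _ := by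
        rw [← neg_eq_iff_eq_neg.mpr (coeff_one_zero_add_coeff_zero_one A B)]
        simp only [harmonicSum, freq]
        ring_nf
    _ ≤ _ := hmain
    _ = _ := by ring

theorem abs_slope_sub_le {A B : ℝ} (hA : 6 / 5 ≤ A) (hAB : A ≤ B) {a b : ℝ} (h : cos a ≠ cos b) :
    |slope A B a b - (B - A - 1 / 2 + secondCoeff A B * (2 * (cos a + cos b)))| ≤
      B * (2 * gaussTail A 4 + 1 / 4 * (2 ^ 4 * exp (-(3 * A)) + gaussTail A 4) ^ 2) := by
  simpa only [slope, chebDiff_one h, mul_one, chebDiff_two h] using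
    abs_harmonicSum_sub_le hA hAB fun k => abs_chebDiff_le k a b

/-! ### Lines on which the energy is smallest at `x = 1 / 2` -/

theorem le_exp_neg {x t c : ℝ} (hx0 : 0 ≤ x) (hx : x ≤ 2) (ht : t ≤ x) (hc : 0 ≤ c)
    (h : c * (∑ m ∈ Finset.range 8, (x / 2) ^ m / m.factorial +
      (x / 2) ^ 8 * (8 + 1) / (Nat.factorial 8 * 8)) ^ 2 ≤ 1) : c ≤ exp (-t) := by
  have hhalf := exp_bound' (x := x / 2) (by linarith) (by linarith) (n := 8) (by norm_num)
  rw [exp_neg, ← one_div, le_div_iff₀ (exp_pos t)]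
  calc c * exp t ≤ c * exp x := by gcongr
    _ = c * exp (x / 2) ^ 2 := by rw [← exp_nat_mul]; push_cast; ring_nf
    _ ≤ 1 := le_trans (by push_cast at hhalf ⊢; gcongr) h

theorem exp_neg_mul_affine_le {κ A A₀ c₀ c₁ : ℝ} (hA : A₀ ≤ A) (h : c₁ ≤ κ * (c₀ + c₁ * A₀))
    (h₀ : 0 ≤ c₀ + c₁ * A₀) :
    exp (-(κ * A)) * (c₀ + c₁ * A) ≤ exp (-(κ * A₀)) * (c₀ + c₁ * A₀) := by
  have hexp : exp (-(κ * A₀)) = exp (-(κ * A)) * exp (κ * (A - A₀)) := by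
    rw [← exp_add]; ring_nf
  rw [hexp, mul_assoc]
  gcongr
  calc c₀ + c₁ * A ≤ (κ * (A - A₀) + 1) * (c₀ + c₁ * A₀) := by nlinarith
    _ ≤ exp (κ * (A - A₀)) * (c₀ + c₁ * A₀) := by gcongr; exact add_one_le_exp _

/-- Here `ε` is a lower bound for `exp (-3 (B - A))`, the ratio of the two exponentials in
`secondCoeff A B`. -/
theorem secondCoeff_le {A B A₀ e ε : ℝ} (hA₀ : 6 / 5 ≤ A₀) (hA : A₀ ≤ A) (hAB : A ≤ B)
    (hAB' : B - A ≤ 1 / 2) (he : exp (-(3 * A₀)) ≤ e) (hε₀ : 0 ≤ ε) (hε₁ : ε ≤ 3 / 5)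
    (hε : ε ≤ exp (-(3 * (B - A)))) :
    secondCoeff A B ≤ e * (3 * (1 - ε) * A₀ + (1 + ε) / 2 - (1 + 4 * ε) * (B - A)) := by
  have hgap : (1 + 4 * ε) * (B - A) ≤ (1 + 4 * ε) * (1 / 2) := by gcongr
  have hpos : 0 ≤ (1 + ε) / 2 - (1 + 4 * ε) * (B - A) + 3 * (1 - ε) * A₀ := by nlinarith
  have hexpB : exp (-(3 * B)) = exp (-(3 * A)) * exp (-(3 * (B - A))) := by
    rw [← exp_add]; ring_nf
  calc secondCoeff A B
      = exp (-(3 * A)) * (4 * A + 1 / 2 - B) -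
          exp (-(3 * A)) * exp (-(3 * (B - A))) * (4 * B - A - 1 / 2) := by
        rw [secondCoeff, hexpB]
    _ ≤ exp (-(3 * A)) * (4 * A + 1 / 2 - B) - exp (-(3 * A)) * ε * (4 * B - A - 1 / 2) := by
        have : 0 ≤ 4 * B - A - 1 / 2 := by linarith
        gcongr
    _ = exp (-(3 * A)) * ((1 + ε) / 2 - (1 + 4 * ε) * (B - A) + 3 * (1 - ε) * A) := by ring
    _ ≤ exp (-(3 * A₀)) * ((1 + ε) / 2 - (1 + 4 * ε) * (B - A) + 3 * (1 - ε) * A₀) :=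
        exp_neg_mul_affine_le hA (by nlinarith) hpos
    _ ≤ e * ((1 + ε) / 2 - (1 + 4 * ε) * (B - A) + 3 * (1 - ε) * A₀) := by gcongr
    _ = e * (3 * (1 - ε) * A₀ + (1 + ε) / 2 - (1 + 4 * ε) * (B - A)) := by ring

theorem gaussTail_four_le {A e : ℝ} (hA : 6 / 5 ≤ A) (he : exp (-(3 * A)) ≤ e) :
    gaussTail A 4 ≤ 15 / 2 * e ^ 2 := by
  have hexp : exp (-(2 * A)) ≤ 23 / 250 := exp_neg_le (x := 12 / 5) 10 (by norm_num)
    (by norm_num) (by linarith) (by norm_num [Finset.sum_range_succ, Nat.factorial])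
  calc gaussTail A 4 = 501 / 500 * 3 ^ 4 * (exp (-(3 * A)) ^ 2 * exp (-(2 * A))) := by
        rw [gaussTail, ← exp_nat_mul, ← exp_add]; push_cast; ring_nf
    _ ≤ 501 / 500 * 3 ^ 4 * (e ^ 2 * (23 / 250)) := by gcongr
    _ ≤ 15 / 2 * e ^ 2 := by linarith [sq_nonneg e]

theorem slope_zero_nonpos {A B A₀ d e ε b a : ℝ} (hA₀ : 6 / 5 ≤ A₀) (hA : A₀ ≤ A) (hAB : A ≤ B)
    (hd : B - A ≤ d) (hb : B ≤ b) (he : exp (-(3 * A₀)) ≤ e) (hε : ε ≤ exp (-(3 * d)))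
    (hε₀ : 0 ≤ ε) (hε₁ : ε ≤ 3 / 5) (he₁ : e ≤ 1 / 16) (hd₁ : d ≤ 1 / 2)
    (hnum : d - 1 / 2 + 4 * e * (3 * (1 - ε) * A₀ + (1 + ε) / 2 - (1 + 4 * ε) * d) +
      b * (e ^ 2 * (15 + (8 + 15 / 4 * e) ^ 2)) ≤ 0) (ha : cos a ≠ 1) :
    slope A B a 0 ≤ 0 := by
  have hmain := (abs_le.mp (abs_slope_sub_le (hA₀.trans hA) hAB (a := a) (b := 0)
    (by rwa [cos_zero]))).2
  rw [cos_zero] at hmain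
  have he₀ : 0 < e := (exp_pos _).trans_le he
  have heA : exp (-(3 * A)) ≤ e := (exp_le_exp.mpr (by linarith)).trans he
  have hgap : (1 + 4 * ε) * (B - A) ≤ (1 + 4 * ε) * (1 / 2) := by gcongr; linarith
  have hsecond : secondCoeff A B * (2 * (cos a + 1)) ≤
      e * (3 * (1 - ε) * A₀ + (1 + ε) / 2 - (1 + 4 * ε) * (B - A)) * 4 := by
    have hcos := neg_one_le_cos a
    exact mul_le_mul (secondCoeff_le hA₀ hA hAB (hd.trans hd₁) he hε₀ hε₁
      (hε.trans (exp_le_exp.mpr (by linarith)))) (by linarith [cos_le_one a]) (by linarith)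
      (mul_nonneg he₀.le (by nlinarith))
  have hrest : B * (2 * gaussTail A 4 + 1 / 4 * (2 ^ 4 * exp (-(3 * A)) + gaussTail A 4) ^ 2) ≤
      b * (2 * (15 / 2 * e ^ 2) + 1 / 4 * (2 ^ 4 * e + 15 / 2 * e ^ 2) ^ 2) := by
    have := gaussTail_four_le (hA₀.trans hA) heA
    have := gaussTail_pos A 4
    have : 0 ≤ b := by linarith
    gcongr
  have hmono : 4 * e * (1 + 4 * ε) * (d - (B - A)) ≤ 1 * (d - (B - A)) := by
    have : 4 * e * (1 + 4 * ε) ≤ 1 / 4 * 4 := by gcongr <;> linarith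
    exact mul_le_mul_of_nonneg_right (by linarith) (by linarith)
  linarith

theorem energy_half_le {α q y : ℝ} (hα : 0 < α) (hy : 0 < y)
    (h : cos (2 * π * q) ≠ 1 → slope (π * α * y) (π * y / α) (2 * π * q) 0 ≤ 0) :
    energy α (1 / 2) y ≤ energy α (1 / 2 - q) y := by
  obtain ⟨C, hC, hsub⟩ := exists_pos_energy_half_sub hα hy q 0
  rw [mul_zero, cos_zero, sub_zero] at hsub
  rw [← sub_nonneg, hsub]
  refine mul_nonneg hC.le ?_
  by_cases hq : cos (2 * π * q) = 1
  · simp [hq]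
  · exact mul_nonneg_of_nonpos_of_nonpos (sub_nonpos.mpr (cos_le_one _)) (h hq)

theorem pi_div_sub_nonneg {α : ℝ} (hα : 0 < α) (hα₁ : α ≤ 1) : 0 ≤ π / α - π * α := by
  rw [sub_nonneg, le_div_iff₀ hα, mul_assoc]
  exact mul_le_of_le_one_right pi_pos.le (by nlinarith)

/-- The strip `l ≤ y ≤ u`, `α₀ ≤ α ≤ 1`, with `κ` bounding the ratio `(B - A) / y`, where
`A = π α y` and `B = π y / α`. -/
theorem slope_zero_nonpos_of_strip {α y a : ℝ} (l u α₀ κ e ε : ℝ) (hα₀ : 0 < α₀)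
    (hα : α₀ ≤ α) (hα₁ : α ≤ 1) (hκ : π / α - π * α ≤ κ) (hl : l ≤ y) (hu : y ≤ u) (hl₀ : 0 < l)
    (hA₀ : 6 / 5 ≤ 3.1415 * α₀ * l) (he₀ : 0 < e)
    (he : 1 ≤ e * ∑ i ∈ Finset.range 24, (3 * (3.1415 * α₀ * l)) ^ i / i.factorial)
    (hε : ε * (∑ m ∈ Finset.range 8, (3 * (κ * u) / 2) ^ m / m.factorial +
      (3 * (κ * u) / 2) ^ 8 * (8 + 1) / (Nat.factorial 8 * 8)) ^ 2 ≤ 1)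
    (hε₀ : 0 ≤ ε) (hε₁ : ε ≤ 3 / 5) (he₁ : e ≤ 1 / 16) (hd₁ : κ * u ≤ 1 / 2)
    (hnum : κ * u - 1 / 2 + 4 * e * (3 * (1 - ε) * (3.1415 * α₀ * l) + (1 + ε) / 2 -
      (1 + 4 * ε) * (κ * u)) +
      (3.1416 * u / α₀) * (e ^ 2 * (15 + (8 + 15 / 4 * e) ^ 2)) ≤ 0) (ha : cos a ≠ 1) :
    slope (π * α * y) (π * y / α) a 0 ≤ 0 := by
  have hgap : π * y / α - π * α * y = (π / α - π * α) * y := by ring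
  have hpos := pi_div_sub_nonneg (hα₀.trans_le hα) hα₁
  have hy : 0 < y := hl₀.trans_le hl
  have hκu : 0 ≤ κ * u := mul_nonneg (hpos.trans hκ) (by linarith)
  refine slope_zero_nonpos (A₀ := 3.1415 * α₀ * l) (d := κ * u) (e := e) (ε := ε)
    (b := 3.1416 * u / α₀) hA₀ ?_ ?_ ?_ ?_ ?_ ?_ hε₀ hε₁ he₁ hd₁ hnum ha
  · have : 0 < α := hα₀.trans_le hα
    gcongr
    exact pi_gt_d4.le
  · rw [← sub_nonneg, hgap]
    positivity
  · rw [hgap]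
    gcongr
    exact hpos.trans hκ
  · have : 0 ≤ u := by linarith
    gcongr
    exact pi_lt_d4.le
  · exact exp_neg_le 24 (by positivity) he₀.le le_rfl he
  · exact le_exp_neg (x := 3 * (κ * u)) (by linarith) (by linarith) le_rfl hε₀ hε

theorem pi_div_sub_le {α α₀ : ℝ} (hα₀ : 0 < α₀) (hα : α₀ ≤ α) (hα₁ : α ≤ 1) :
    π / α - π * α ≤ 3.1416 * (1 / α₀ - α₀) := by
  have hpos := pi_div_sub_nonneg (hα₀.trans_le hα) hα₁
  calc π / α - π * α = π * (1 / α - α) := by ring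
    _ ≤ 3.1416 * (1 / α - α) := by
      have : 0 ≤ 1 / α - α := nonneg_of_mul_nonneg_right (by rwa [mul_sub, mul_one_div]) pi_pos
      gcongr
      exact pi_lt_d4.le
    _ ≤ 3.1416 * (1 / α₀ - α₀) := by gcongr

theorem slope_zero_nonpos_of_near_one {α y a : ℝ} (hα : 0.936 ≤ α) (hα₁ : α ≤ 1) (hl : 0.43 ≤ y)
    (hu : y ≤ 0.49) (ha : cos a ≠ 1) : slope (π * α * y) (π * y / α) a 0 ≤ 0 := by
  refine slope_zero_nonpos_of_strip 0.43 0.49 0.936 0.4159 0.02253 0.542 (by norm_num) hα hα₁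
    ((pi_div_sub_le (by norm_num) hα hα₁).trans (by norm_num)) hl hu
    ?_ ?_ ?_ ?_ ?_ ?_ ?_ ?_ ?_ ?_ ha <;> norm_num [Finset.sum_range_succ, Nat.factorial]

theorem slope_zero_nonpos_of_gap_le {α y a : ℝ} (hα : 0.9 ≤ α) (hα₁ : α ≤ 1)
    (hκ : π / α - π * α ≤ 0.5774) (hl : 0.499 ≤ y) (hu : y ≤ 0.8) (ha : cos a ≠ 1) :
    slope (π * α * y) (π * y / α) a 0 ≤ 0 := by
  rcases le_total y 0.552 with h₁ | h₁
  · refine slope_zero_nonpos_of_strip 0.499 0.552 0.9 0.5774 0.01452 0.384 (by norm_num) hα hα₁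
      hκ hl h₁ ?_ ?_ ?_ ?_ ?_ ?_ ?_ ?_ ?_ ?_ ha <;> norm_num [Finset.sum_range_succ, Nat.factorial]
  rcases le_total y 0.643 with h₂ | h₂
  · refine slope_zero_nonpos_of_strip 0.552 0.643 0.9 0.5774 0.00926 0.328 (by norm_num) hα hα₁
      hκ h₁ h₂ ?_ ?_ ?_ ?_ ?_ ?_ ?_ ?_ ?_ ?_ ha <;> norm_num [Finset.sum_range_succ, Nat.factorial]
  rcases le_total y 0.743 with h₃ | h₃
  · refine slope_zero_nonpos_of_strip 0.643 0.743 0.9 0.5774 0.00428 0.276 (by norm_num) hα hα₁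
      hκ h₂ h₃ ?_ ?_ ?_ ?_ ?_ ?_ ?_ ?_ ?_ ?_ ha <;> norm_num [Finset.sum_range_succ, Nat.factorial]
  · refine slope_zero_nonpos_of_strip 0.743 0.8 0.9 0.5774 0.00184 0.25 (by norm_num) hα hα₁
      hκ h₃ hu ?_ ?_ ?_ ?_ ?_ ?_ ?_ ?_ ?_ ?_ ha <;> norm_num [Finset.sum_range_succ, Nat.factorial]

theorem slope_zero_nonpos_of_large_parameter {α y a : ℝ} (hα : 0.918 ≤ α) (hα₁ : α ≤ 1)
    (hl : 0.48 ≤ y) (hu : y ≤ 0.8661) (ha : cos a ≠ 1) :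
    slope (π * α * y) (π * y / α) a 0 ≤ 0 := by
  have hκ : π / α - π * α ≤ 0.5383 :=
    (pi_div_sub_le (by norm_num) hα hα₁).trans (by norm_num)
  rcases le_total y 0.5 with h | h
  · refine slope_zero_nonpos_of_strip 0.48 0.5 0.918 0.5383 0.01573 0.445 (by norm_num) hα hα₁
      hκ hl h ?_ ?_ ?_ ?_ ?_ ?_ ?_ ?_ ?_ ?_ ha <;> norm_num [Finset.sum_range_succ, Nat.factorial]
  rcases le_total y 0.8 with h' | h'
  · exact slope_zero_nonpos_of_gap_le (by linarith) hα₁ (hκ.trans (by norm_num)) (by linarith) h' ha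
  · refine slope_zero_nonpos_of_strip 0.8 0.8661 0.918 0.5383 0.00099 0.246 (by norm_num) hα hα₁
      hκ h' hu ?_ ?_ ?_ ?_ ?_ ?_ ?_ ?_ ?_ ?_ ha <;> norm_num [Finset.sum_range_succ, Nat.factorial]

/-! ### Lines on which the energy is smallest at `x = 0` -/

/-- `gaussWeight A 2 r` times the amount by which `A (r ^ 2 - 1)` exceeds `δ`. With
`δ = B - A - 1 / 2`, it controls the negative part of the coefficients `coeff A B q` with
`q.1 + 1 = r`. -/
noncomputable def deficit (A δ r : ℝ) : ℝ := gaussWeight A 2 r * max (A * (r ^ 2 - 1) - δ) 0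

theorem deficit_nonneg (A δ : ℝ) {r : ℝ} (hr : 0 ≤ r) : 0 ≤ deficit A δ r :=
  mul_nonneg (gaussWeight_nonneg A 2 hr) (le_max_right _ _)

theorem neg_le_coeff_mul_one_sub_cos (A : ℝ) {B : ℝ} (hB : 0 ≤ B) (q : ℕ × ℕ) (t : ℝ) :
    -((1 - cos t) * (deficit A (B - A - 1 / 2) (q.1 + 1) * gaussWeight B 2 (q.2 + 1))) ≤
      coeff A B q * (1 - cos (freq q * t)) := by
  have hweight : 0 ≤ weight A B q := by rw [weight]; positivity
  rw [deficit, coeff]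
  set μ := max (A * (((q.1 : ℝ) + 1) ^ 2 - 1) - (B - A - 1 / 2)) 0
  have _hμ : 0 ≤ μ := le_max_right _ _
  have hfactor : -μ ≤ B * ((q.2 : ℝ) + 1) ^ 2 - A * ((q.1 : ℝ) + 1) ^ 2 - 1 / 2 := by
    have hexcess : A * (((q.1 : ℝ) + 1) ^ 2 - 1) - (B - A - 1 / 2) ≤ μ := le_max_left _ _
    have hone : B * 1 ≤ B * ((q.2 : ℝ) + 1) ^ 2 := by
      gcongr
      exact one_le_pow₀ (by linarith [q.2.cast_nonneg (α := ℝ)])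
    linarith
  calc -((1 - cos t) * (gaussWeight A 2 (q.1 + 1) * μ * gaussWeight B 2 (q.2 + 1)))
      = -(weight A B q * μ * (freq q ^ 2 * (1 - cos t))) := by
        linear_combination (1 - cos t) * μ * freq_pow_mul_weight A B 2 q
    _ ≤ -(weight A B q * μ * (1 - cos (freq q * t))) := by
        gcongr
        exact one_sub_cos_nat_mul_le _ _
    _ = weight A B q * -μ * (1 - cos (freq q * t)) := by ring
    _ ≤ _ := by
        have := sub_nonneg.mpr (cos_le_one (freq q * t))
        gcongr

theorem tsum_gaussWeight_two_add_one_le {P : ℝ} (hP : 27 / 10 ≤ P) :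
    ∑' j : ℕ, gaussWeight P 2 (j + 1) ≤ 501 / 500 := by
  have hP' : 6 / 5 ≤ P := by linarith
  have hexp : exp (-(3 * P)) ≤ 1 / 3000 := exp_neg_le (x := 81 / 10) 16 (by norm_num)
    (by norm_num) (by linarith) (by norm_num [Finset.sum_range_succ, Nat.factorial])
  have hexp' : exp (-(8 * P)) ≤ 1 / 3000 * (1 / 3000) := by
    calc exp (-(8 * P)) ≤ exp (-(3 * P)) * exp (-(3 * P)) := by
          rw [← exp_add]; exact exp_le_exp.mpr (by linarith)
      _ ≤ _ := by gcongr
  have hshift (j : ℕ) : gaussWeight P 2 ((j + 1 : ℕ) + 1) = gaussWeight P 2 (j + 2) := by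
    push_cast
    ring_nf
  have htail := tsum_gaussWeight_add_two_le hP' (n := 2) (by norm_num)
  rw [gaussTail] at htail
  have hfirst : gaussWeight P 2 ((0 : ℕ) + 1) = 1 := by simp [gaussWeight]
  rw [(summable_gaussWeight_add_one hP' (by norm_num)).tsum_eq_zero_add, tsum_congr hshift, hfirst]
  linarith

theorem energy_zero_le_of_tsum_deficit_le {α y : ℝ} (hα : 0 < α) (hy : 0 < y)
    (hB : 27 / 10 ≤ π * y / α)
    (hS : Summable fun i : ℕ => deficit (π * α * y) (π * y / α - π * α * y - 1 / 2) (i + 1))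
    (h : (∑' i : ℕ, deficit (π * α * y) (π * y / α - π * α * y - 1 / 2) (i + 1)) * (501 / 500) ≤
      π * y / α - π * α * y - 1 / 2) (x : ℝ) :
    energy α 0 y ≤ energy α x y := by
  obtain ⟨C, hC, hsub⟩ := exists_pos_energy_sub_energy hα hy x 0
  have hcos (q : ℕ × ℕ) : cos (2 * π * freq q * 0) - cos (2 * π * freq q * x) =
      1 - cos (freq q * (2 * π * x)) := by
    rw [mul_zero, cos_zero]; ring_nf
  simp only [hcos] at hsub
  have hA₀ : 0 < π * α * y := by positivity
  set A := π * α * y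
  set B := π * y / α
  set s := 1 - cos (2 * π * x) with hs
  have hs₀ : 0 ≤ s := sub_nonneg.mpr (cos_le_one _)
  set U : ℕ → ℝ := fun i => deficit A (B - A - 1 / 2) (i + 1)
  have hU₀ (i : ℕ) : 0 ≤ U i := deficit_nonneg _ _ (by positivity)
  set V : ℕ → ℝ := fun j => gaussWeight B 2 (j + 1)
  have hV₀ (j : ℕ) : 0 ≤ V j := gaussWeight_nonneg _ _ (by positivity)
  have hV : Summable V := summable_gaussWeight_add_one (by linarith) (by norm_num)
  have hUV : Summable fun q : ℕ × ℕ => U q.1 * V q.2 := hS.mul_of_nonneg hV hU₀ hV₀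
  have hcoeff : Summable fun q => coeff A B q * (1 - cos (freq q * (2 * π * x))) :=
    summable_coeff_mul_of_bounded (C := 2) hA₀ (by linarith) fun q => by
      rw [abs_le]
      constructor <;> linarith [neg_one_le_cos (freq q * (2 * π * x)),
        cos_le_one (freq q * (2 * π * x))]
  have hterm (q : ℕ × ℕ) :
      0 ≤ coeff A B q * (1 - cos (freq q * (2 * π * x))) + s * (U q.1 * V q.2) :=
    neg_le_iff_add_nonneg.mp (neg_le_coeff_mul_one_sub_cos A (by linarith) q (2 * π * x))
  have hleading : (B - A - 1 / 2) * s ≤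
      ∑' q, (coeff A B q * (1 - cos (freq q * (2 * π * x))) + s * (U q.1 * V q.2)) := by
    refine le_trans ?_ ((hcoeff.add (hUV.mul_left s)).le_tsum (0, 0) fun q _ => hterm q)
    rw [coeff_zero_zero, freq_cast]
    simpa [hs] using mul_nonneg hs₀ (mul_nonneg (hU₀ 0) (hV₀ 0))
  rw [hcoeff.tsum_add (hUV.mul_left s), tsum_mul_left, ← hS.tsum_mul_tsum hV hUV] at hleading
  have hprod : (∑' i, U i) * ∑' j, V j ≤ B - A - 1 / 2 :=
    (mul_le_mul_of_nonneg_left (tsum_gaussWeight_two_add_one_le hB) (tsum_nonneg hU₀)).trans h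
  rw [← sub_nonneg, hsub]
  exact mul_nonneg hC.le (by linarith [mul_le_mul_of_nonneg_left hprod hs₀])

theorem energy_zero_le_of_dominated {α y : ℝ} (hα : 0 < α) (hy : 0 < y) {U : ℕ → ℝ}
    (hU : Summable U)
    (hdom : ∀ i : ℕ, deficit (π * α * y) (π * y / α - π * α * y - 1 / 2) (i + 2) ≤ U i)
    (hB : 27 / 10 ≤ π * y / α)
    (h : (∑' i, U i) * (501 / 500) ≤ π * y / α - π * α * y - 1 / 2) (x : ℝ) :
    energy α 0 y ≤ energy α x y := by
  set A := π * α * y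
  set δ := π * y / α - A - 1 / 2
  have hnonneg (i : ℕ) : 0 ≤ deficit A δ (i + 2) := deficit_nonneg _ _ (by positivity)
  have hshift (i : ℕ) : deficit A δ ((i + 1 : ℕ) + 1) = deficit A δ (i + 2) := by
    push_cast
    ring_nf
  have hS₂ : Summable fun i : ℕ => deficit A δ (i + 2) := .of_nonneg_of_le hnonneg hdom hU
  have hS : Summable fun i : ℕ => deficit A δ (i + 1) :=
    (summable_nat_add_iff 1).mp (hS₂.congr fun i => (hshift i).symm)
  have hδ : 0 ≤ δ :=
    (mul_nonneg (tsum_nonneg fun i => (hnonneg i).trans (hdom i)) (by norm_num)).trans h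
  have hzero : deficit A δ ((0 : ℕ) + 1) = 0 := by simp [deficit, hδ]
  refine energy_zero_le_of_tsum_deficit_le hα hy hB hS (le_trans ?_ h) x
  rw [hS.tsum_eq_zero_add, hzero, zero_add, tsum_congr hshift]
  exact mul_le_mul_of_nonneg_right (hS₂.tsum_le_tsum hdom hU) (by norm_num)

theorem pow_four_mul_exp_neg_le {t : ℝ} (ht : 0 ≤ t) : t ^ 4 * exp (-t) ≤ 469 / 100 := by
  have hexp : exp (-4) ≤ 469 / 25600 := exp_neg_le (x := 4) 20 (by norm_num)
    (by norm_num) le_rfl (by norm_num [Finset.sum_range_succ, Nat.factorial])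
  calc t ^ 4 * exp (-t) = 256 * ((t / 4 - 1 + 1) ^ 4 * exp (-t)) := by ring
    _ ≤ 256 * (exp (t / 4 - 1) ^ 4 * exp (-t)) := by
      gcongr
      · linarith
      · exact add_one_le_exp _
    _ = 256 * exp (-4) := by rw [← exp_nat_mul, ← exp_add]; push_cast; ring_nf
    _ ≤ 469 / 100 := by linarith

theorem summable_one_div_add_two_sq : Summable fun i : ℕ => 1 / ((i : ℝ) + 2) ^ 2 :=
  ((summable_nat_add_iff 2).mpr hasSum_zeta_two.summable).congr fun i => by push_cast; rfl

theorem tsum_one_div_add_two_sq_le : ∑' i : ℕ, 1 / ((i : ℝ) + 2) ^ 2 ≤ 645 / 1000 := by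
  have hzeta := hasSum_zeta_two.summable.sum_add_tsum_nat_add 2
  rw [hasSum_zeta_two.tsum_eq] at hzeta
  norm_num [Finset.sum_range_succ] at hzeta
  simp only [one_div]
  nlinarith [pi_lt_d4, pi_pos]

theorem deficit_le_of_two_le {A δ r : ℝ} (hA : 0 < A) (hδ : 0 < δ) (hr : 2 ≤ r) :
    deficit A δ r ≤ 2.085 / (δ * A ^ 2) * (1 / r ^ 2) := by
  have hr₂ : 2 ^ 2 ≤ r ^ 2 := by gcongr
  have hexcess : 3 / 4 * (A * r ^ 2) ≤ A * (r ^ 2 - 1) := by nlinarith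
  have hgauss : gaussWeight A 2 r = r ^ 2 * exp (-(A * (r ^ 2 - 1))) := rfl
  rw [deficit, hgauss]
  set t := A * (r ^ 2 - 1)
  have ht : 0 < t := lt_of_lt_of_le (by positivity) hexcess
  have hmax : max (t - δ) 0 ≤ t ^ 2 / (4 * δ) := by
    refine max_le ?_ (by positivity)
    rw [le_div_iff₀ (by positivity)]
    nlinarith [sq_nonneg (t - 2 * δ)]
  calc r ^ 2 * exp (-t) * max (t - δ) 0 ≤ r ^ 2 * exp (-t) * (t ^ 2 / (4 * δ)) := by gcongr
    _ = r ^ 2 / (4 * δ) * (t ^ 4 * exp (-t) / t ^ 2) := by field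
    _ ≤ r ^ 2 / (4 * δ) * (469 / 100 / (3 / 4 * (A * r ^ 2)) ^ 2) := by
      gcongr
      exact pow_four_mul_exp_neg_le ht.le
    _ = 469 / 225 / (δ * A ^ 2) * (1 / r ^ 2) := by field
    _ ≤ 2.085 / (δ * A ^ 2) * (1 / r ^ 2) := by gcongr; norm_num

theorem energy_zero_le_of_small {α y : ℝ} (hα : 0 < α) (hα₁ : α ≤ 1) (hy : 0 < y)
    (hy₂ : 3 / 4 ≤ y ^ 2) (hA : π * α * y ≤ 9 / 4) (x : ℝ) : energy α 0 y ≤ energy α x y := by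
  have hA₀ : 0 < π * α * y := by positivity
  have hprod : 7.4 ≤ π * α * y * (π * y / α) := by
    calc 7.4 ≤ 3.1415 ^ 2 * (3 / 4) := by norm_num
      _ ≤ π ^ 2 * y ^ 2 := by gcongr; exact pi_gt_d4.le
      _ = _ := by field
  have hAB : π * α * y ≤ π * y / α := by
    rw [← sub_nonneg]
    calc 0 ≤ (π / α - π * α) * y := mul_nonneg (pi_div_sub_nonneg hα hα₁) hy.le
      _ = _ := by ring
  set A := π * α * y
  set B := π * y / α
  have hB : 27 / 10 ≤ B := by nlinarith
  have hδA : 1.2 ≤ (B - A - 1 / 2) * A := by nlinarith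
  have hδ : 0 < B - A - 1 / 2 := pos_of_mul_pos_left (by linarith) hA₀.le
  refine energy_zero_le_of_dominated hα hy (summable_one_div_add_two_sq.mul_left _)
    (fun i => deficit_le_of_two_le hA₀ hδ (by linarith [i.cast_nonneg (α := ℝ)])) hB ?_ x
  set δ := B - A - 1 / 2
  rw [tsum_mul_left]
  calc _ ≤ 2.085 / (δ * A ^ 2) * (645 / 1000) * (501 / 500) := by
        gcongr
        exact tsum_one_div_add_two_sq_le
    _ ≤ δ := by
        rw [div_mul_eq_mul_div, div_mul_eq_mul_div, div_le_iff₀ (by positivity)]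
        have : 1.2 ^ 2 ≤ (δ * A) ^ 2 := by gcongr
        linarith

theorem mul_exp_neg_le_mul_exp_neg {s t : ℝ} (hs : 1 ≤ s) (hst : s ≤ t) :
    t * exp (-t) ≤ s * exp (-s) := by
  calc t * exp (-t) ≤ s * (t - s + 1) * exp (-t) := by gcongr; nlinarith
    _ ≤ s * exp (t - s) * exp (-t) := by gcongr; exact add_one_le_exp _
    _ = s * exp (-s) := by rw [mul_assoc, ← exp_add]; ring_nf

theorem deficit_le_of_le {P A δ r : ℝ} (hP : 1 ≤ P) (hA : P ≤ A) (hδ : 0 ≤ δ) (hr : 2 ≤ r) :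
    deficit A δ r ≤ P * (gaussWeight P 4 r - gaussWeight P 2 r) := by
  have hr₂ : 2 ^ 2 ≤ r ^ 2 := by gcongr
  have hmax : max (A * (r ^ 2 - 1) - δ) 0 ≤ A * (r ^ 2 - 1) := max_le (by linarith) (by nlinarith)
  have hmono := mul_exp_neg_le_mul_exp_neg (s := P * (r ^ 2 - 1)) (t := A * (r ^ 2 - 1))
    (by nlinarith) (by nlinarith)
  calc deficit A δ r ≤ gaussWeight A 2 r * (A * (r ^ 2 - 1)) :=
        mul_le_mul_of_nonneg_left hmax (gaussWeight_nonneg _ _ (by linarith))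
    _ = r ^ 2 * (A * (r ^ 2 - 1) * exp (-(A * (r ^ 2 - 1)))) := by rw [gaussWeight]; ring
    _ ≤ r ^ 2 * (P * (r ^ 2 - 1) * exp (-(P * (r ^ 2 - 1)))) := by gcongr
    _ = P * (gaussWeight P 4 r - gaussWeight P 2 r) := by rw [gaussWeight, gaussWeight]; ring

theorem energy_zero_le_of_large {α y : ℝ} (hα : 0 < α) (hy : 0 < y) (hA : 9 / 4 ≤ π * α * y)
    (hδ : 0.54 ≤ π * y / α - π * α * y) (x : ℝ) : energy α 0 y ≤ energy α x y := by
  have hfour := summable_gaussWeight_add_two (P := 9 / 4) (n := 4) (by norm_num) (by norm_num)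
  have htwo := summable_gaussWeight_add_two (P := 9 / 4) (n := 2) (by norm_num) (by norm_num)
  refine energy_zero_le_of_dominated hα hy ((hfour.sub htwo).mul_left (9 / 4)) (fun i =>
    deficit_le_of_le (by norm_num) hA (by linarith) (by linarith [i.cast_nonneg (α := ℝ)]))
    (by linarith) ?_ x
  rw [tsum_mul_left, hfour.tsum_sub htwo]
  have hupper := tsum_gaussWeight_add_two_le (P := 9 / 4) (n := 4) (by norm_num) (by norm_num)
  have hlower := htwo.le_tsum 0 fun i _ => gaussWeight_nonneg (9 / 4) 2 (by positivity)
  norm_num [gaussWeight, gaussTail] at hupper hlower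
  have hexp : exp (-(27 / 4)) ≤ 1 / 850 := exp_neg_le (x := 27 / 4) 20 (by norm_num)
    (by norm_num) le_rfl (by norm_num [Finset.sum_range_succ, Nat.factorial])
  have hexp' : exp (-18) ≤ 1 / 850 * (1 / 850) := by
    calc exp (-18) ≤ exp (-(27 / 4)) * exp (-(27 / 4)) := by
          rw [← exp_add]; exact exp_le_exp.mpr (by norm_num)
      _ ≤ _ := by gcongr
  norm_num [gaussWeight] at *
  linarith

theorem energy_zero_le {α y : ℝ} (hα : 0 < α) (hα₁ : α ≤ 1) (hy : 0 < y) (hy₂ : 3 / 4 ≤ y ^ 2)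
    (hδ : 0.54 ≤ π * y / α - π * α * y) (x : ℝ) : energy α 0 y ≤ energy α x y := by
  rcases le_total (π * α * y) (9 / 4) with h | h
  · exact energy_zero_le_of_small hα hα₁ hy hy₂ h x
  · exact energy_zero_le_of_large hα hy h hδ x

/-! ### Comparison of slopes at different heights -/

theorem abs_mul_sub_half_le {l z : ℝ} (hz : 0 ≤ z) : |l * z - 1 / 2| ≤ |l| * z + 1 / 2 := by
  calc |l * z - 1 / 2| ≤ |l * z| + |1 / 2| := abs_sub _ _
    _ = |l| * z + 1 / 2 := by rw [abs_mul, abs_of_nonneg hz]; norm_num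

theorem abs_exp_mul_affine_sub_le {κ l y z : ℝ} (hκ : 0 ≤ κ) (hy : 0 ≤ y) (hyz : y ≤ z) :
    |exp (-(κ * z)) * (l * z - 1 / 2) - exp (-(κ * y)) * (l * y - 1 / 2)| ≤
      (z - y) * (exp (-(κ * y)) * (|l| + κ * (|l| * z + 1 / 2))) := by
  set r := exp (-(κ * (z - y))) with hr
  have hsub : 0 ≤ κ * (z - y) := mul_nonneg hκ (by linarith)
  have hexp : exp (-(κ * z)) = exp (-(κ * y)) * r := by
    rw [hr, ← exp_add]; ring_nf
  have hr₁ : r ≤ 1 := exp_le_one_iff.mpr (by linarith)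
  have hr₂ : 1 - r ≤ κ * (z - y) := by linarith [add_one_le_exp (-(κ * (z - y)))]
  have hfactor : exp (-(κ * z)) * (l * z - 1 / 2) - exp (-(κ * y)) * (l * y - 1 / 2) =
      exp (-(κ * y)) * (l * (z - y) - (1 - r) * (l * z - 1 / 2)) := by
    rw [hexp]; ring
  rw [hfactor, abs_mul, abs_exp]
  calc _ ≤ exp (-(κ * y)) * (|l * (z - y)| + |(1 - r) * (l * z - 1 / 2)|) := by
        gcongr
        exact abs_sub _ _
    _ = exp (-(κ * y)) * (|l| * (z - y) + (1 - r) * |l * z - 1 / 2|) := by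
        rw [abs_mul, abs_mul, abs_of_nonneg (sub_nonneg.mpr hyz),
          abs_of_nonneg (sub_nonneg.mpr hr₁)]
    _ ≤ exp (-(κ * y)) * (|l| * (z - y) + κ * (z - y) * (|l| * z + 1 / 2)) := by
        gcongr
        exact abs_mul_sub_half_le (hy.trans hyz)
    _ = _ := by ring

/-- The exponential rate at which `weight (a * y) (b * y) q` decays in `y`. -/
def decayRate (a b : ℝ) (q : ℕ × ℕ) : ℝ :=
  a * (((q.1 : ℝ) + 1) ^ 2 - 1) + b * (((q.2 : ℝ) + 1) ^ 2 - 1)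

/-- The coefficient of `y` in the affine factor of `coeff (a * y) (b * y) q`. -/
def affineRate (a b : ℝ) (q : ℕ × ℕ) : ℝ := b * ((q.2 : ℝ) + 1) ^ 2 - a * ((q.1 : ℝ) + 1) ^ 2

theorem exp_neg_decayRate (a b y : ℝ) (q : ℕ × ℕ) :
    exp (-(decayRate a b q * y)) = weight (a * y) (b * y) q := by
  rw [weight, decayRate]
  ring_nf

theorem coeff_eq_exp_mul_affine (a b y : ℝ) (q : ℕ × ℕ) :
    coeff (a * y) (b * y) q = exp (-(decayRate a b q * y)) * (affineRate a b q * y - 1 / 2) := by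
  rw [exp_neg_decayRate, coeff, affineRate]
  ring

theorem one_le_natCast_add_one_sq (i : ℕ) : 1 ≤ ((i : ℝ) + 1) ^ 2 :=
  one_le_pow₀ (le_add_of_nonneg_left i.cast_nonneg)

theorem one_le_freq_sq (q : ℕ × ℕ) : 1 ≤ (freq q : ℝ) ^ 2 := by
  rw [freq_cast, mul_pow]
  exact one_le_mul_of_one_le_of_one_le (one_le_natCast_add_one_sq _) (one_le_natCast_add_one_sq _)

theorem abs_affineRate_le {a b c : ℝ} (ha : 0 ≤ a) (hac : a ≤ c) (hb : 0 ≤ b) (hbc : b ≤ c)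
    (q : ℕ × ℕ) : |affineRate a b q| ≤ c * freq q ^ 2 := by
  have hm := one_le_natCast_add_one_sq q.1
  have hl := one_le_natCast_add_one_sq q.2
  rw [freq_cast, mul_pow, affineRate]
  refine abs_sub_le_of_nonneg_of_le (by positivity) ?_ (by positivity) ?_
  · exact mul_le_mul hbc (le_mul_of_one_le_left (by positivity) hm) (by positivity) (hb.trans hbc)
  · exact mul_le_mul hac (le_mul_of_one_le_right (by positivity) hl) (by positivity) (ha.trans hac)

theorem decayRate_nonneg {a b : ℝ} (ha : 0 ≤ a) (hb : 0 ≤ b) (q : ℕ × ℕ) :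
    0 ≤ decayRate a b q :=
  add_nonneg (mul_nonneg ha (sub_nonneg.mpr (one_le_natCast_add_one_sq _)))
    (mul_nonneg hb (sub_nonneg.mpr (one_le_natCast_add_one_sq _)))

theorem decayRate_le {a b c : ℝ} (hac : a ≤ c) (hbc : b ≤ c) (hc : 0 ≤ c) (q : ℕ × ℕ) :
    decayRate a b q ≤ c * freq q ^ 2 := by
  have hm := sub_nonneg.mpr (one_le_natCast_add_one_sq q.1)
  have hl := sub_nonneg.mpr (one_le_natCast_add_one_sq q.2)
  rw [freq_cast, mul_pow, decayRate]
  linarith [mul_le_mul_of_nonneg_right hac hm, mul_le_mul_of_nonneg_right hbc hl,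
    mul_nonneg hc (mul_nonneg hm hl)]

theorem abs_coeff_sub_le {a b y z P Q : ℝ} (ha : 0 ≤ a) (hab : a ≤ b) (hb : b ≤ 7 / 2)
    (hy₀ : 0 ≤ y) (hz₀ : 0 ≤ z) (hy : y ≤ 1.01) (hz : z ≤ 1.01) (hP : P ≤ a * y)
    (hQ : Q ≤ b * y) (hP' : P ≤ a * z) (hQ' : Q ≤ b * z) (q : ℕ × ℕ) :
    |coeff (a * z) (b * z) q - coeff (a * y) (b * y) q| ≤
      |z - y| * (17.7 * (freq q : ℝ) ^ 4 * weight P Q q) := by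
  wlog hyz : y ≤ z generalizing y z
  · rw [abs_sub_comm, abs_sub_comm z]
    exact this hz₀ hy₀ hz hy hP' hQ' hP hQ (le_of_not_ge hyz)
  have hb₀ := ha.trans hab
  have haffine := abs_affineRate_le ha (hab.trans hb) hb₀ hb q
  have hκ := decayRate_nonneg ha hb₀ q
  have hκ' := decayRate_le (hab.trans hb) hb (by norm_num) q
  have hfactor : |affineRate a b q| + decayRate a b q * (|affineRate a b q| * z + 1 / 2) ≤
      17.7 * (freq q : ℝ) ^ 4 := by
    calc _ ≤ 7 / 2 * (freq q : ℝ) ^ 2 +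
          7 / 2 * (freq q : ℝ) ^ 2 * (7 / 2 * (freq q : ℝ) ^ 2 * 1.01 + 1 / 2) := by gcongr
      _ ≤ 17.7 * (freq q : ℝ) ^ 4 := by nlinarith [one_le_freq_sq q]
  rw [coeff_eq_exp_mul_affine, coeff_eq_exp_mul_affine, abs_of_nonneg (sub_nonneg.mpr hyz)]
  refine (abs_exp_mul_affine_sub_le hκ hy₀ hyz).trans ?_
  rw [exp_neg_decayRate, mul_comm _ (weight P Q q)]
  have := sub_nonneg.mpr hyz
  have : 0 ≤ weight P Q q := exp_nonneg _
  gcongr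
  exact weight_le_weight hP hQ q

theorem abs_coeff_le_weight {a b y P Q : ℝ} (ha : 0 ≤ a) (hab : a ≤ b) (hb : b ≤ 7 / 2)
    (hy₀ : 0 ≤ y) (hy : y ≤ 1.01) (hP : P ≤ a * y) (hQ : Q ≤ b * y) (q : ℕ × ℕ) :
    |coeff (a * y) (b * y) q| ≤ 4.08 * (freq q : ℝ) ^ 2 * weight P Q q := by
  rw [coeff_eq_exp_mul_affine, abs_mul, abs_exp, exp_neg_decayRate, mul_comm _ (weight P Q q)]
  have : 0 ≤ weight P Q q := exp_nonneg _
  gcongr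
  · exact weight_le_weight hP hQ q
  calc |affineRate a b q * y - 1 / 2| ≤ |affineRate a b q| * y + 1 / 2 := abs_mul_sub_half_le hy₀
    _ ≤ 7 / 2 * (freq q : ℝ) ^ 2 * 1.01 + 1 / 2 := by
      gcongr
      exact abs_affineRate_le ha (hab.trans hb) (ha.trans hab) hb q
    _ ≤ 4.08 * (freq q : ℝ) ^ 2 := by linarith [one_le_freq_sq q]

/-- A bound for the sum of `freq q ^ 6 * weight P Q q` over the indices `q` with
`3 ≤ freq q`. -/
noncomputable def tailBound (P Q : ℝ) : ℝ :=
  gaussTail P 6 + gaussTail Q 6 +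
    (2 ^ 6 * exp (-(3 * P)) + gaussTail P 6) * (2 ^ 6 * exp (-(3 * Q)) + gaussTail Q 6)

theorem abs_coeff_mul_chebDiff_sub_le {a b y y₀ P Q s t : ℝ} (ha : 0 ≤ a) (hab : a ≤ b)
    (hb : b ≤ 7 / 2) (hy₀ : 0 ≤ y) (hy₀' : 0 ≤ y₀) (hy : y ≤ 1.01) (hy' : y₀ ≤ 1.01)
    (hP : P ≤ a * y) (hQ : Q ≤ b * y) (hP' : P ≤ a * y₀) (hQ' : Q ≤ b * y₀)
    (hst : cos s ≠ cos t) (q : ℕ × ℕ) :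
    |coeff (a * y) (b * y) q * ((-1) ^ (freq q + 1) * chebDiff (freq q) s t) -
      coeff (a * y₀) (b * y₀) q * ((-1) ^ (freq q + 1) * (freq q : ℝ) ^ 2)| ≤
      (17.7 * |y - y₀| + 0.68 * (2 - cos s - cos t)) * (freq q ^ 6 * weight P Q q) := by
  have hdiff : 0 ≤ (freq q : ℝ) ^ 2 - chebDiff (freq q) s t :=
    sub_nonneg.mpr (abs_le.mp (abs_chebDiff_le (freq q) s t)).2
  have hsplit : coeff (a * y) (b * y) q * ((-1) ^ (freq q + 1) * chebDiff (freq q) s t) -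
      coeff (a * y₀) (b * y₀) q * ((-1) ^ (freq q + 1) * (freq q : ℝ) ^ 2) =
      (-1) ^ (freq q + 1) *
        ((coeff (a * y) (b * y) q - coeff (a * y₀) (b * y₀) q) * (freq q : ℝ) ^ 2 -
          coeff (a * y) (b * y) q * ((freq q : ℝ) ^ 2 - chebDiff (freq q) s t)) := by ring
  rw [hsplit, abs_mul, abs_pow, abs_neg, abs_one, one_pow, one_mul]
  refine (abs_sub _ _).trans ?_
  rw [abs_mul, abs_mul, abs_of_nonneg hdiff, abs_of_nonneg (sq_nonneg (freq q : ℝ))]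
  have : 0 ≤ weight P Q q := exp_nonneg _
  calc _ ≤ |y - y₀| * (17.7 * (freq q : ℝ) ^ 4 * weight P Q q) * (freq q : ℝ) ^ 2 +
        4.08 * (freq q : ℝ) ^ 2 * weight P Q q *
          ((freq q : ℝ) ^ 4 / 6 * (2 - cos s - cos t)) := by
        gcongr
        · exact abs_coeff_sub_le ha hab hb hy₀' hy₀ hy' hy hP' hQ' hP hQ q
        · exact abs_coeff_le_weight ha hab hb hy₀ hy hP hQ q
        · exact sq_sub_chebDiff_le hst (freq q)
    _ = _ := by ring

theorem abs_slope_sub_harmonicSum_sq_le {a b y y₀ P Q s t : ℝ} (ha : 0 ≤ a) (hab : a ≤ b)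
    (hb : b ≤ 7 / 2) (hy : y ≤ 1.01) (hy' : y₀ ≤ 1.01) (hP : P ≤ a * y) (hQ : Q ≤ b * y)
    (hP' : P ≤ a * y₀) (hQ' : Q ≤ b * y₀) (hP₀ : 6 / 5 ≤ P) (hQ₀ : 6 / 5 ≤ Q)
    (hst : cos s ≠ cos t) :
    |slope (a * y) (b * y) s t - harmonicSum (a * y₀) (b * y₀) (fun k => (k : ℝ) ^ 2) -
      ((b - a) * (y - y₀) + 4 * (secondCoeff (a * y) (b * y) - secondCoeff (a * y₀) (b * y₀)) -
        2 * secondCoeff (a * y) (b * y) * (2 - cos s - cos t))| ≤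
      (17.7 * |y - y₀| + 0.68 * (2 - cos s - cos t)) * tailBound P Q := by
  have hy₀ : 0 ≤ y := (pos_of_mul_pos_right (by linarith) ha).le
  have hy₀' : 0 ≤ y₀ := (pos_of_mul_pos_right (by linarith) ha).le
  have : 0 ≤ 2 - cos s - cos t := by linarith [cos_le_one s, cos_le_one t]
  have hslope := summable_coeff_mul_sign (A := a * y) (B := b * y) (by linarith) (by gcongr)
    fun k => abs_chebDiff_le k s t
  have hsq := summable_coeff_mul_sign (A := a * y₀) (B := b * y₀) (τ := fun k => (k : ℝ) ^ 2)
    (by linarith) (by gcongr) fun k => (abs_of_nonneg (sq_nonneg _)).le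
  have hc : 0 ≤ 17.7 * |y - y₀| + 0.68 * (2 - cos s - cos t) := by positivity
  have hbound := abs_coeff_mul_chebDiff_sub_le ha hab hb hy₀ hy₀' hy hy' hP hQ hP' hQ' hst
  have hmain := abs_tsum_sub_leading_le hP₀ hQ₀ (n := 6) le_rfl hc hc hbound
    fun i j => hbound (i + 1, j + 1)
  rw [hslope.tsum_sub hsq] at hmain
  have hsecond := coeff_one_zero_add_coeff_zero_one (a * y) (b * y)
  have hsecond₀ := coeff_one_zero_add_coeff_zero_one (a * y₀) (b * y₀)
  rw [coeff_zero_zero, coeff_zero_zero, show freq (0, 0) = 1 from rfl,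
    show freq (1, 0) = 2 from rfl, show freq (0, 1) = 2 from rfl, chebDiff_one hst,
    chebDiff_two hst, Nat.cast_one, Nat.cast_two] at hmain
  calc _ = _ := by
        rw [slope, harmonicSum, harmonicSum]
        congr 2
        linear_combination 2 * (cos s + cos t) * hsecond - 4 * hsecond₀
    _ ≤ _ := hmain
    _ = _ := by rw [tailBound]; ring

/-! ### The critical range of `α` -/

/-- The pairs `(π α, π / α)` with `α` close to the value `≈ 0.91` at which the leading coefficient
of the cosine series changes sign at the height `√3 / 2`, described by numerical bounds. -/
structure CriticalPair (a b : ℝ) : Prop where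
  left_ge : 2.827 ≤ a
  left_le : a ≤ 2.885
  right_ge : 3.422 ≤ b
  right_le : b ≤ 3.491
  gap : 0.538 ≤ b - a

theorem pi_div_sub_ge {α α₀ : ℝ} (hα : 0 < α) (h : α ≤ α₀) (hα₀ : α₀ ≤ 1) :
    3.1415 * (1 / α₀ - α₀) ≤ π / α - π * α := by
  have hpos : 0 < α₀ := hα.trans_le h
  have hgap : 0 ≤ 1 / α₀ - α₀ := sub_nonneg.mpr (hα₀.trans (one_le_one_div hpos hα₀))
  calc 3.1415 * (1 / α₀ - α₀) ≤ π * (1 / α₀ - α₀) := by gcongr; exact pi_gt_d4.le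
    _ ≤ π * (1 / α - α) := by gcongr
    _ = _ := by ring

theorem criticalPair {α : ℝ} (hl : 0.9 ≤ α) (hu : α ≤ 0.918) : CriticalPair (π * α) (π / α) := by
  have hπ := pi_gt_d4
  have hπ' := pi_lt_d4
  have hα : 0 < α := by linarith
  exact
  { left_ge := by nlinarith
    left_le := by nlinarith
    right_ge := by rw [le_div_iff₀ hα]; nlinarith
    right_le := by rw [div_le_iff₀ hα]; nlinarith
    gap := le_trans (by norm_num) (pi_div_sub_ge hα hu (by norm_num)) }

theorem secondCoeff_mul (a b y : ℝ) : secondCoeff (a * y) (b * y) =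
    exp (-(3 * a * y)) * (1 / 2 + (4 * a - b) * y) -
      exp (-(3 * b * y)) * (-(1 / 2) + (4 * b - a) * y) := by
  rw [secondCoeff]
  ring_nf

theorem exp_neg_left_mul_le {a b y z : ℝ} (h : CriticalPair a b) (hy : 0.8 ≤ y) (hyz : y ≤ z) :
    exp (-(3 * a * z)) * (1 / 2 + (4 * a - b) * z) ≤
      exp (-(3 * a * y)) * (1 / 2 + (4 * a - b) * y) := by
  obtain ⟨ha, -, -, hb', -⟩ := h
  have hrate : (4 * a - b) * 0.8 ≤ (4 * a - b) * y := by gcongr; linarith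
  refine exp_neg_mul_affine_le hyz ?_ (by linarith)
  calc 4 * a - b ≤ 3 * (1 / 2 + (4 * a - b) * y) := by linarith
    _ ≤ 3 * a * (1 / 2 + (4 * a - b) * y) := by gcongr <;> linarith

theorem exp_neg_right_mul_le {a b y z : ℝ} (h : CriticalPair a b) (hy : 0.8 ≤ y) (hyz : y ≤ z) :
    exp (-(3 * b * z)) * (-(1 / 2) + (4 * b - a) * z) ≤
      exp (-(3 * b * y)) * (-(1 / 2) + (4 * b - a) * y) := by
  obtain ⟨-, ha', hb, -, -⟩ := h
  have hrate : (4 * b - a) * 0.8 ≤ (4 * b - a) * y := by gcongr; linarith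
  refine exp_neg_mul_affine_le hyz ?_ (by linarith)
  calc 4 * b - a ≤ 3 * (-(1 / 2) + (4 * b - a) * y) := by linarith
    _ ≤ 3 * b * (-(1 / 2) + (4 * b - a) * y) := by gcongr <;> linarith

theorem secondCoeff_sub_le {a b y z : ℝ} (h : CriticalPair a b) (hy : 0.8 ≤ y) (hyz : y ≤ z) :
    secondCoeff (a * y) (b * y) - secondCoeff (a * z) (b * z) ≤
      (z - y) * (exp (-(3 * a * y)) * (8.655 * (1 / 2 + 8.118 * z))) := by
  have hright := exp_neg_right_mul_le h hy hyz
  obtain ⟨ha, ha', hb, hb', -⟩ := h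
  have hz : 0 ≤ z := by linarith
  have hrate : 0 ≤ 4 * a - b := by linarith
  have : 0 ≤ 1 / 2 + (4 * a - b) * z := by positivity
  have hexp : exp (-(3 * a * z)) = exp (-(3 * a * y)) * exp (-(3 * a * (z - y))) := by
    rw [← exp_add]; ring_nf
  have hleft : exp (-(3 * a * y)) * (1 / 2 + (4 * a - b) * y) -
      exp (-(3 * a * z)) * (1 / 2 + (4 * a - b) * z) ≤
      exp (-(3 * a * y)) * ((z - y) * (8.655 * (1 / 2 + 8.118 * z))) := by
    rw [hexp, mul_assoc (exp (-(3 * a * y))), ← mul_sub]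
    gcongr
    calc 1 / 2 + (4 * a - b) * y - exp (-(3 * a * (z - y))) * (1 / 2 + (4 * a - b) * z)
        ≤ 1 / 2 + (4 * a - b) * z -
            (-(3 * a * (z - y)) + 1) * (1 / 2 + (4 * a - b) * z) := by
          gcongr
          exact add_one_le_exp _
      _ = (z - y) * (3 * a * (1 / 2 + (4 * a - b) * z)) := by ring
      _ ≤ (z - y) * (8.655 * (1 / 2 + 8.118 * z)) := by
          gcongr
          all_goals linarith
  rw [secondCoeff_mul, secondCoeff_mul]
  linarith

theorem le_secondCoeff {a b y : ℝ} (h : CriticalPair a b) (hy : 0.8 ≤ y) (hy' : y ≤ 0.8661) :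
    0.001 ≤ secondCoeff (a * y) (b * y) := by
  have hleft := exp_neg_left_mul_le h hy hy'
  have hright := exp_neg_right_mul_le h le_rfl hy
  obtain ⟨ha, ha', hb, hb', -⟩ := h
  have hexp_ge : 0.0005 ≤ exp (-(3 * a * 0.8661)) := by
    have hroot : 0.15 ≤ exp (-(3 * a * 0.8661 / 4)) :=
      le_exp_neg (x := 1.875) (by norm_num) (by norm_num) (by linarith) (by norm_num)
        (by norm_num [Finset.sum_range_succ, Nat.factorial])
    calc (0.0005 : ℝ) ≤ 0.15 ^ 4 := by norm_num
      _ ≤ exp (-(3 * a * 0.8661 / 4)) ^ 4 := by gcongr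
      _ = _ := by rw [← exp_nat_mul]; push_cast; ring_nf
  have hexp_le : exp (-(3 * b * 0.8)) ≤ 0.000275 := exp_neg_le (x := 8.2128) 24 (by norm_num)
    (by norm_num) (by linarith) (by norm_num [Finset.sum_range_succ, Nat.factorial])
  have hleft_ge : 0.0005 * (1 / 2 + 7.81 * 0.8661) ≤
      exp (-(3 * a * 0.8661)) * (1 / 2 + (4 * a - b) * 0.8661) := by
    gcongr; linarith
  have hright_le : exp (-(3 * b * 0.8)) * (-(1 / 2) + (4 * b - a) * 0.8) ≤
      0.000275 * (-(1 / 2) + 11.14 * 0.8) := by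
    gcongr <;> linarith
  rw [secondCoeff_mul]
  linarith

theorem tailBound_le {P Q p p' q : ℝ} (hp : exp (-(3 * P)) ≤ p) (hp' : exp (-(2 * P)) ≤ p')
    (hQ : 0 ≤ Q) (hq : exp (-(3 * Q)) ≤ q) :
    tailBound P Q ≤ 501 / 500 * 3 ^ 6 * (p ^ 2 * p') + 501 / 500 * 3 ^ 6 * q ^ 2 +
      (2 ^ 6 * p + 501 / 500 * 3 ^ 6 * (p ^ 2 * p')) * (2 ^ 6 * q + 501 / 500 * 3 ^ 6 * q ^ 2) := by
  have : 0 ≤ p := (exp_nonneg _).trans hp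
  have hP₈ : exp (-(8 * P)) ≤ p ^ 2 * p' :=
    calc exp (-(8 * P)) = exp (-(3 * P)) ^ 2 * exp (-(2 * P)) := by
          rw [← exp_nat_mul, ← exp_add]; push_cast; ring_nf
      _ ≤ p ^ 2 * p' := by gcongr
  have : 0 ≤ p ^ 2 * p' := (exp_nonneg _).trans hP₈
  have hQ₈ : exp (-(8 * Q)) ≤ q ^ 2 :=
    calc exp (-(8 * Q)) ≤ exp (-(3 * Q)) ^ 2 := by
          rw [← exp_nat_mul]; exact exp_le_exp.mpr (by push_cast; linarith)
      _ ≤ q ^ 2 := by gcongr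
  rw [tailBound, gaussTail, gaussTail]
  gcongr

theorem tailBound_nonneg (P Q : ℝ) : 0 ≤ tailBound P Q := by
  have := gaussTail_pos P 6
  have := gaussTail_pos Q 6
  rw [tailBound]
  positivity

theorem exp_neg_le_of_critical_above {t : ℝ} (ht : 3 * 2.448 ≤ t) : exp (-t) ≤ 1 / 1540 :=
  exp_neg_le (x := 3 * 2.448) 24 (by norm_num) (by norm_num) ht
    (by norm_num [Finset.sum_range_succ, Nat.factorial])

theorem exp_neg_le_of_critical_below {t : ℝ} (ht : 3 * 2.261 ≤ t) : exp (-t) ≤ 1 / 880 :=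
  exp_neg_le (x := 3 * 2.261) 24 (by norm_num) (by norm_num) ht
    (by norm_num [Finset.sum_range_succ, Nat.factorial])

theorem tailBound_above : tailBound 2.448 2.963 ≤ 0.0005 := by
  have hp : exp (-(2 * 2.448)) ≤ 0.008 := exp_neg_le (x := 4.896) 20 (by norm_num) (by norm_num)
    (by norm_num) (by norm_num [Finset.sum_range_succ, Nat.factorial])
  have hq : exp (-(3 * 2.963)) ≤ 1 / 7200 := exp_neg_le (x := 3 * 2.963) 28 (by norm_num)
    (by norm_num) le_rfl (by norm_num [Finset.sum_range_succ, Nat.factorial])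
  exact (tailBound_le (exp_neg_le_of_critical_above le_rfl) hp (by norm_num) hq).trans (by norm_num)

theorem tailBound_below : tailBound 2.261 2.737 ≤ 0.0015 := by
  have hp : exp (-(2 * 2.261)) ≤ 0.011 := exp_neg_le (x := 4.522) 20 (by norm_num) (by norm_num)
    (by norm_num) (by norm_num [Finset.sum_range_succ, Nat.factorial])
  have hq : exp (-(3 * 2.737)) ≤ 1 / 3650 := exp_neg_le (x := 3 * 2.737) 28 (by norm_num)
    (by norm_num) le_rfl (by norm_num [Finset.sum_range_succ, Nat.factorial])
  exact (tailBound_le (exp_neg_le_of_critical_below le_rfl) hp (by norm_num) hq).trans (by norm_num)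

theorem sqrt_three_half_sq : (√3 / 2) ^ 2 = 3 / 4 := by
  rw [div_pow, sq_sqrt (by norm_num)]
  norm_num

theorem le_sqrt_three_half : 0.866 ≤ √3 / 2 := by
  have : 1.732 ≤ √3 := le_sqrt_of_sq_le (by norm_num)
  linarith

theorem sqrt_three_half_le : √3 / 2 ≤ 0.8661 := by
  have : √3 ≤ 1.7322 := sqrt_le_iff.mpr (by norm_num)
  linarith

theorem secondCoeff_le_of_critical {a b y : ℝ} (h : CriticalPair a b) (hy : √3 / 2 ≤ y) :
    secondCoeff (a * y) (b * y) ≤ 0.0049 := by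
  have hl := le_sqrt_three_half
  have hu := sqrt_three_half_le
  have hleft := exp_neg_left_mul_le h (by linarith) hy
  obtain ⟨ha, ha', hb, hb', -⟩ := h
  have hright : 0 ≤ exp (-(3 * b * y)) * (-(1 / 2) + (4 * b - a) * y) :=
    mul_nonneg (exp_nonneg _) (by nlinarith)
  have hrate : 0 ≤ 4 * a - b := by linarith
  have hexp : exp (-(3 * a * (√3 / 2))) ≤ 1 / 1540 := exp_neg_le_of_critical_above (by nlinarith)
  rw [secondCoeff_mul]
  calc _ ≤ exp (-(3 * a * (√3 / 2))) * (1 / 2 + (4 * a - b) * (√3 / 2)) := by linarith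
    _ ≤ 1 / 1540 * (1 / 2 + 8.118 * 0.8661) := by
        gcongr
        linarith
    _ ≤ 0.0049 := by norm_num

theorem secondCoeff_sub_le_above {a b y : ℝ} (h : CriticalPair a b) (hy : √3 / 2 ≤ y)
    (hy' : y ≤ 1.01) : secondCoeff (a * (√3 / 2)) (b * (√3 / 2)) - secondCoeff (a * y) (b * y) ≤
      (y - √3 / 2) * 0.049 := by
  have hl := le_sqrt_three_half
  have ha := h.left_ge
  calc _ ≤ (y - √3 / 2) * (exp (-(3 * a * (√3 / 2))) * (8.655 * (1 / 2 + 8.118 * y))) :=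
        secondCoeff_sub_le h (by linarith) hy
    _ ≤ (y - √3 / 2) * (1 / 1540 * (8.655 * (1 / 2 + 8.118 * 1.01))) := by
        have : 0 ≤ y := by linarith
        gcongr
        exact exp_neg_le_of_critical_above (by nlinarith)
    _ ≤ (y - √3 / 2) * 0.049 := by
        gcongr
        norm_num

theorem secondCoeff_sub_le_below {a b y : ℝ} (h : CriticalPair a b) (hy : 0.8 ≤ y)
    (hy' : y ≤ √3 / 2) : secondCoeff (a * y) (b * y) - secondCoeff (a * (√3 / 2)) (b * (√3 / 2)) ≤
      (√3 / 2 - y) * 0.08 := by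
  have ha := h.left_ge
  calc _ ≤ (√3 / 2 - y) * (exp (-(3 * a * y)) * (8.655 * (1 / 2 + 8.118 * (√3 / 2)))) :=
        secondCoeff_sub_le h hy hy'
    _ ≤ (√3 / 2 - y) * (1 / 880 * (8.655 * (1 / 2 + 8.118 * 0.8661))) := by
        gcongr
        · exact exp_neg_le_of_critical_below (by nlinarith)
        · exact sqrt_three_half_le
    _ ≤ (√3 / 2 - y) * 0.08 := by
        gcongr
        norm_num

/-- `hhex` says that, at the height `√3 / 2` of the hexagonal lattice, the second derivative of the
energy in `x` at `x = 1 / 2` is nonpositive. -/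
theorem slope_nonneg_of_critical {a b y s t : ℝ} (h : CriticalPair a b)
    (hhex : 0 ≤ harmonicSum (a * (√3 / 2)) (b * (√3 / 2)) fun k => (k : ℝ) ^ 2)
    (hy : √3 / 2 ≤ y) (hy' : y ≤ 1.01) (hst : cos t < cos s)
    (ht : 1 - cos t ≤ 8 * (y ^ 2 - 3 / 4)) : 0 ≤ slope (a * y) (b * y) s t := by
  have hl := le_sqrt_three_half
  have hu := sqrt_three_half_le
  have hsub := secondCoeff_sub_le_above h hy hy'
  have hsecond := secondCoeff_le_of_critical h hy
  obtain ⟨ha, ha', hb, hb', hgap⟩ := h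
  have hmain := abs_slope_sub_harmonicSum_sq_le (a := a) (b := b) (y₀ := √3 / 2) (P := 2.448)
    (Q := 2.963) (by linarith) (by linarith) (by linarith) hy' (by linarith) (by nlinarith)
    (by nlinarith) (by nlinarith) (by nlinarith) (by norm_num) (by norm_num) hst.ne'
  have hv : 0 ≤ y - √3 / 2 := sub_nonneg.mpr hy
  rw [abs_of_nonneg hv] at hmain
  set Δ := 2 - cos s - cos t
  have hΔ : 0 ≤ Δ := by linarith [cos_le_one s, cos_le_one t]
  have hΔ' : Δ ≤ 30.04 * (y - √3 / 2) :=
    calc Δ ≤ 16 * (y ^ 2 - (√3 / 2) ^ 2) := by rw [sqrt_three_half_sq]; linarith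
      _ = 16 * (y + √3 / 2) * (y - √3 / 2) := by ring
      _ ≤ 30.04 * (y - √3 / 2) := by gcongr; linarith
  have htail : (17.7 * (y - √3 / 2) + 0.68 * Δ) * tailBound 2.448 2.963 ≤
      (17.7 * (y - √3 / 2) + 0.68 * (30.04 * (y - √3 / 2))) * 0.0005 := by
    have : 0 ≤ tailBound 2.448 2.963 := tailBound_nonneg _ _
    gcongr
    exact tailBound_above
  have hsecondΔ : secondCoeff (a * y) (b * y) * Δ ≤ 0.0049 * (30.04 * (y - √3 / 2)) := by
    calc _ ≤ 0.0049 * Δ := by gcongr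
      _ ≤ _ := by gcongr
  have : 0.538 * (y - √3 / 2) ≤ (b - a) * (y - √3 / 2) := by gcongr
  linarith [(abs_le.mp hmain).1]

theorem slope_zero_nonpos_of_critical {a b y s : ℝ} (h : CriticalPair a b)
    (hhex : harmonicSum (a * (√3 / 2)) (b * (√3 / 2)) (fun k => (k : ℝ) ^ 2) ≤ 0)
    (hy : 0.8 ≤ y) (hy' : y ≤ √3 / 2) (hs : cos s ≠ 1) : slope (a * y) (b * y) s 0 ≤ 0 := by
  have hu := sqrt_three_half_le
  have hsub := secondCoeff_sub_le_below h hy hy'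
  have hsecond := le_secondCoeff h hy (hy'.trans hu)
  obtain ⟨ha, ha', hb, hb', hgap⟩ := h
  have hmain := abs_slope_sub_harmonicSum_sq_le (a := a) (b := b) (y := y) (y₀ := √3 / 2)
    (P := 2.261) (Q := 2.737) (s := s) (t := 0) (by linarith) (by linarith) (by linarith)
    (by linarith) (by linarith) (by nlinarith) (by nlinarith) (by nlinarith) (by nlinarith)
    (by norm_num) (by norm_num) (by rwa [cos_zero])
  have hv : 0 ≤ √3 / 2 - y := sub_nonneg.mpr hy'
  rw [abs_sub_comm y, abs_of_nonneg hv, cos_zero] at hmain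
  have hΔ : 0 ≤ 2 - cos s - 1 := by linarith [cos_le_one s]
  have htail : (17.7 * (√3 / 2 - y) + 0.68 * (2 - cos s - 1)) * tailBound 2.261 2.737 ≤
      (17.7 * (√3 / 2 - y) + 0.68 * (2 - cos s - 1)) * 0.0015 := by
    gcongr
    exact tailBound_below
  have hsecondΔ : 0.001 * (2 - cos s - 1) ≤ secondCoeff (a * y) (b * y) * (2 - cos s - 1) := by
    gcongr
  have : 0.538 * (√3 / 2 - y) ≤ (b - a) * (√3 / 2 - y) := by gcongr
  linarith [(abs_le.mp hmain).2]

theorem gap_le_of_harmonicSum_nonpos {a b : ℝ} (h : CriticalPair a b)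
    (hhex : harmonicSum (a * (√3 / 2)) (b * (√3 / 2)) (fun k => (k : ℝ) ^ 2) ≤ 0) :
    b - a ≤ 0.5774 := by
  by_contra! hgap
  have hl := le_sqrt_three_half
  have hu := sqrt_three_half_le
  have hsecond := le_secondCoeff h (by linarith) hu
  obtain ⟨ha, -, -, hb', -⟩ := h
  have hA : 2.448 ≤ a * (√3 / 2) := by nlinarith
  have hmain := abs_harmonicSum_sub_le (A := a * (√3 / 2)) (B := b * (√3 / 2))
    (τ := fun k => (k : ℝ) ^ 2) (by linarith) (by gcongr; linarith)
    fun k => (abs_of_nonneg (sq_nonneg _)).le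
  have hexp : exp (-(3 * (a * (√3 / 2)))) ≤ 1 / 1540 := exp_neg_le_of_critical_above (by linarith)
  have herror : b * (√3 / 2) * (2 * gaussTail (a * (√3 / 2)) 4 + 1 / 4 *
      (2 ^ 4 * exp (-(3 * (a * (√3 / 2)))) + gaussTail (a * (√3 / 2)) 4) ^ 2) ≤
      3.491 * 0.8661 * (2 * (15 / 2 * (1 / 1540) ^ 2) +
        1 / 4 * (2 ^ 4 * (1 / 1540) + 15 / 2 * (1 / 1540) ^ 2) ^ 2) := by
    have htail := gaussTail_four_le (by linarith) hexp
    have := gaussTail_pos (a * (√3 / 2)) 4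
    gcongr
  have : 0.5774 * 0.866 ≤ (b - a) * (√3 / 2) := by gcongr
  norm_num at hmain
  linarith [(abs_le.mp hmain).1]

/-! ### Points far up the half-plane -/

theorem exp_neg_three_mul_le {A : ℝ} (hA : 2.9 ≤ A) : exp (-(3 * A)) ≤ 1 / 5900 :=
  exp_neg_le (x := 8.7) 30 (by norm_num) (by norm_num) (by linarith)
    (by norm_num [Finset.sum_range_succ, Nat.factorial])

theorem mul_exp_neg_three_mul_le {A B : ℝ} (hA : 2.9 ≤ A) (hB : B ≤ A + 1) :
    B * exp (-(3 * A)) ≤ 1 / 1500 :=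
  calc B * exp (-(3 * A)) ≤ exp (-(3 * A)) * (1 + 1 * A) := by
        rw [mul_comm]; gcongr; linarith
    _ ≤ exp (-(3 * 2.9)) * (1 + 1 * 2.9) := exp_neg_mul_affine_le hA (by norm_num) (by norm_num)
    _ ≤ 1 / 5900 * (1 + 1 * 2.9) := by gcongr; exact exp_neg_three_mul_le le_rfl
    _ ≤ 1 / 1500 := by norm_num

theorem gaussTail_four_le_exp {A : ℝ} (hA : 2.9 ≤ A) : gaussTail A 4 ≤ exp (-(3 * A)) := by
  calc gaussTail A 4 ≤ 15 / 2 * exp (-(3 * A)) * exp (-(3 * A)) := by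
        simpa [sq, mul_assoc] using gaussTail_four_le (by linarith) le_rfl
    _ ≤ 15 / 2 * (1 / 5900) * exp (-(3 * A)) := by gcongr; exact exp_neg_three_mul_le hA
    _ ≤ exp (-(3 * A)) := by linarith [exp_pos (-(3 * A))]

theorem abs_coeff_mul_le {A B : ℝ} (hA : 1 ≤ A) (hAB : A ≤ B) {u : ℕ × ℕ → ℝ}
    (hu : ∀ q, |u q| ≤ 1) (q : ℕ × ℕ) :
    |coeff A B q * u q| ≤ B * (freq q ^ 4 * weight A A q) := by
  refine le_trans ?_ (abs_coeff_mul_sign_le_of_one_le (τ := fun k => (k : ℝ) ^ 2) hA hAB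
    (fun k => (abs_of_nonneg (by positivity)).le) q)
  rw [abs_mul, abs_mul]
  refine mul_le_mul_of_nonneg_left ?_ (abs_nonneg _)
  rw [abs_mul, abs_pow, abs_neg, abs_one, one_pow, one_mul]
  exact (hu q).trans ((one_le_freq_sq q).trans (le_abs_self _))

theorem abs_tsum_coeff_mul_le {A B : ℝ} (hA : 2.9 ≤ A) (hAB : A ≤ B) (hB : B ≤ A + 1)
    {u : ℕ × ℕ → ℝ} (hu : ∀ q, |u q| ≤ 1) : |∑' q, coeff A B q * u q| ≤ 1 := by
  have hA₁ : 6 / 5 ≤ A := by linarith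
  have hB₀ : 0 ≤ B := by linarith
  have hterm := abs_coeff_mul_le (by linarith) hAB hu
  have hmain := abs_tsum_sub_leading_le hA₁ hA₁ (by norm_num) hB₀ hB₀ hterm
    fun i j => hterm (i + 1, j + 1)
  have hzero : |coeff A B (0, 0) * u (0, 0)| ≤ 1 / 2 := by
    rw [coeff_zero_zero, abs_mul]
    have : |B - A - 1 / 2| ≤ 1 / 2 := abs_le.mpr ⟨by linarith, by linarith⟩
    exact (mul_le_mul this (hu _) (abs_nonneg _) (by norm_num)).trans_eq (mul_one _)
  have hone : |coeff A B (1, 0) * u (1, 0)| ≤ 16 * (B * exp (-(3 * A))) :=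
    (hterm (1, 0)).trans_eq (by norm_num [freq, weight, mul_comm A]; ring)
  have htwo : |coeff A B (0, 1) * u (0, 1)| ≤ 16 * (B * exp (-(3 * A))) :=
    (hterm (0, 1)).trans_eq (by norm_num [freq, weight, mul_comm A]; ring)
  have hexp := mul_exp_neg_three_mul_le hA hB
  have hrest : B * (gaussTail A 4 + gaussTail A 4) +
      B * ((2 ^ 4 * exp (-(3 * A)) + gaussTail A 4) * (2 ^ 4 * exp (-(3 * A)) + gaussTail A 4)) ≤
      1 / 100 := by
    have := (gaussTail_pos A 4).le
    have htail := gaussTail_four_le_exp hA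
    have hsmall := exp_neg_three_mul_le hA
    calc _ ≤ B * (exp (-(3 * A)) + exp (-(3 * A))) +
          B * ((2 ^ 4 * exp (-(3 * A)) + exp (-(3 * A))) * (2 ^ 4 * (1 / 5900) + 1 / 5900)) := by
          gcongr
          exact htail.trans hsmall
      _ = B * exp (-(3 * A)) * (2 + 17 ^ 2 / 5900) := by ring
      _ ≤ 1 / 1500 * (2 + 17 ^ 2 / 5900) := by gcongr
      _ ≤ 1 / 100 := by norm_num
  rw [abs_le] at hmain hzero hone htwo ⊢
  constructor <;> linarith

theorem kernel_zero_succ (A B : ℝ) (j : ℕ) : kernel A B (0, (j : ℤ) + 1) =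
    -(exp (-(B * ((j : ℝ) + 1) ^ 2)) * (B * ((j : ℝ) + 1) ^ 2 - 1 / 2)) := by
  rw [kernel]
  push_cast
  ring_nf

theorem kernel_succ_zero (A B : ℝ) (i : ℕ) : kernel A B ((i : ℤ) + 1, 0) =
    exp (-(A * ((i : ℝ) + 1) ^ 2)) * (A * ((i : ℝ) + 1) ^ 2 + 1 / 2) := by
  rw [kernel]
  push_cast
  ring_nf

theorem summable_kernel_zero_succ {A B : ℝ} (hA : 0 < A) (hB : 0 < B) :
    Summable fun j : ℕ => kernel A B (0, (j : ℤ) + 1) :=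
  (summable_abs_kernel hA hB).of_abs.comp_injective (i := fun j : ℕ => ((0 : ℤ), (j : ℤ) + 1))
    fun _ _ h => by simpa using h

theorem summable_kernel_succ_zero {A B : ℝ} (hA : 0 < A) (hB : 0 < B) :
    Summable fun i : ℕ => kernel A B ((i : ℤ) + 1, 0) :=
  (summable_abs_kernel hA hB).of_abs.comp_injective (i := fun i : ℕ => ((i : ℤ) + 1, (0 : ℤ)))
    fun _ _ h => by simpa using h

theorem exp_neg_mul_add_sub_half_le {X t : ℝ} (hX : 0 ≤ X) (ht : 0 ≤ t) :
    exp (-t) * (X + t - 1 / 2) ≤ X + 1 / 2 := by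
  have hexp : exp (-t) ≤ 1 := exp_le_one_iff.mpr (by linarith)
  have hmul : exp (-t) * (2 * t) ≤ 1 := by
    calc exp (-t) * (2 * t) ≤ exp (-t) * exp t := by
          gcongr
          linarith [quadratic_le_exp_of_nonneg ht, sq_nonneg (t - 1)]
      _ = 1 := by rw [← exp_add, neg_add_cancel, exp_zero]
  linarith [mul_le_mul_of_nonneg_right hexp hX, exp_pos (-t)]

theorem tsum_kernel_axes_nonneg {A B : ℝ} (hA : 0 < A) (hAB : A ≤ B) :
    0 ≤ ∑' j : ℕ, kernel A B (0, (j : ℤ) + 1) + ∑' i : ℕ, kernel A B ((i : ℤ) + 1, 0) := by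
  have hB := hA.trans_le hAB
  rw [← (summable_kernel_zero_succ hA hB).tsum_add (summable_kernel_succ_zero hA hB)]
  refine tsum_nonneg fun i => ?_
  rw [kernel_zero_succ, kernel_succ_zero]
  set n := ((i : ℝ) + 1) ^ 2
  have hexp : exp (-(B * n)) = exp (-(A * n)) * exp (-((B - A) * n)) := by
    rw [← exp_add]; ring_nf
  have hterm := mul_le_mul_of_nonneg_left (exp_neg_mul_add_sub_half_le (X := A * n)
    (t := (B - A) * n) (by positivity) (mul_nonneg (by linarith) (by positivity)))
    (exp_nonneg (-(A * n)))
  rw [hexp]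
  linarith

theorem tsum_kernel_succ_zero_le {A B : ℝ} (hA : 6 / 5 ≤ A) (hA' : A ≤ 3.5) (hB : 0 < B) :
    ∑' i : ℕ, kernel A B ((i : ℤ) + 1, 0) ≤
      exp (-A) * (A + 1 / 2) + 4 * exp (-A) * (2 ^ 4 * exp (-(3 * A)) + gaussTail A 4) := by
  have hs := summable_kernel_succ_zero (by linarith : 0 < A) hB
  have hterm (i : ℕ) :
      kernel A B (((i + 1 : ℕ) : ℤ) + 1, 0) ≤ 4 * exp (-A) * gaussWeight A 4 (i + 2) := by
    have hi : (2 : ℝ) ≤ (i : ℝ) + 2 := le_add_of_nonneg_left i.cast_nonneg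
    rw [kernel_succ_zero, gaussWeight]
    push_cast
    rw [show (i : ℝ) + 1 + 1 = i + 2 by ring]
    generalize (i : ℝ) + 2 = m at *
    have hexp : exp (-(A * m ^ 2)) = exp (-A) * exp (-(A * (m ^ 2 - 1))) := by
      rw [← exp_add]; ring_nf
    have hm : 4 ≤ m ^ 2 := by nlinarith
    have hm₄ : 4 * m ^ 2 ≤ m ^ 4 := by nlinarith
    calc _ ≤ exp (-A) * exp (-(A * (m ^ 2 - 1))) * (3.5 * m ^ 2 + 1 / 2) := by rw [hexp]; gcongr
      _ ≤ exp (-A) * exp (-(A * (m ^ 2 - 1))) * (4 * m ^ 4) := by gcongr; linarith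
      _ = _ := by ring
  rw [hs.tsum_eq_zero_add]
  gcongr
  · rw [kernel_succ_zero]; norm_num
  calc _ ≤ ∑' i : ℕ, 4 * exp (-A) * gaussWeight A 4 (i + 2) :=
        ((summable_nat_add_iff 1).mpr hs).tsum_le_tsum hterm
          ((summable_gaussWeight_add_two hA (by norm_num)).mul_left _)
    _ ≤ _ := by
        rw [tsum_mul_left]
        gcongr
        exact tsum_gaussWeight_add_two_le hA (by norm_num)

theorem tsum_kernel_zero_succ_le {A B : ℝ} (hA : 0 < A) (hB : 1 / 2 ≤ B) :
    ∑' j : ℕ, kernel A B (0, (j : ℤ) + 1) ≤ -(exp (-B) * (B - 1 / 2)) := by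
  have hneg (j : ℕ) : kernel A B (0, (j : ℤ) + 1) ≤ 0 := by
    rw [kernel_zero_succ, neg_nonpos]
    have := mul_le_mul hB (one_le_natCast_add_one_sq j) zero_le_one (by linarith)
    exact mul_nonneg (exp_nonneg _) (by linarith)
  rw [(summable_kernel_zero_succ hA (by linarith)).tsum_eq_zero_add]
  refine (add_le_of_nonpos_right (tsum_nonpos fun j => hneg (j + 1))).trans_eq ?_
  rw [kernel_zero_succ]
  norm_num

theorem tsum_kernel_succ_zero_le_of_ge {A B : ℝ} (hA : 2.984 ≤ A) (hA' : A ≤ 3.5) (hB : 0 < B) :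
    ∑' i : ℕ, kernel A B ((i : ℤ) + 1, 0) ≤ 0.1768 := by
  have hexp : exp (-2.984) ≤ 1 / 19.76 := exp_neg_le (x := 2.984) 20 (by norm_num)
    (by norm_num) le_rfl (by norm_num [Finset.sum_range_succ, Nat.factorial])
  have hexp₃ : exp (-(3 * A)) ≤ 1 / 7000 := exp_neg_le (x := 8.9) 30 (by norm_num)
    (by norm_num) (by linarith) (by norm_num [Finset.sum_range_succ, Nat.factorial])
  have hleading : exp (-A) * (A + 1 / 2) ≤ 1 / 19.76 * 3.484 :=
    calc exp (-A) * (A + 1 / 2) = exp (-(1 * A)) * (1 / 2 + 1 * A) := by ring_nf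
      _ ≤ exp (-(1 * 2.984)) * (1 / 2 + 1 * 2.984) :=
          exp_neg_mul_affine_le hA (by norm_num) (by norm_num)
      _ ≤ 1 / 19.76 * 3.484 := by norm_num at hexp ⊢; linarith
  have htail : 4 * exp (-A) * (2 ^ 4 * exp (-(3 * A)) + gaussTail A 4) ≤
      4 * (1 / 19.76) * (2 ^ 4 * (1 / 7000) + 15 / 2 * (1 / 7000) ^ 2) := by
    have := gaussTail_pos A 4
    gcongr
    · exact (exp_le_exp.mpr (neg_le_neg hA)).trans hexp
    · exact gaussTail_four_le (by linarith) hexp₃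
  linarith [tsum_kernel_succ_zero_le (by linarith : 6 / 5 ≤ A) hA' hB]

theorem tsum_kernel_zero_succ_le_of_le {A B : ℝ} (hA : 0 < A) (hB : 3 / 2 ≤ B) (hB' : B ≤ 3.307) :
    ∑' j : ℕ, kernel A B (0, (j : ℤ) + 1) ≤ -0.1024 := by
  have hexp : 0.0365 ≤ exp (-3.307) := by
    have hhalf : 0.1912 ≤ exp (-1.6535) := le_exp_neg (x := 1.6535) (by norm_num) (by norm_num)
      le_rfl (by norm_num) (by norm_num [Finset.sum_range_succ, Nat.factorial])
    calc (0.0365 : ℝ) ≤ 0.1912 ^ 2 := by norm_num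
      _ ≤ exp (-1.6535) ^ 2 := by gcongr
      _ = exp (-3.307) := by rw [← exp_nat_mul]; norm_num
  have hleading : 0.0365 * 2.807 ≤ exp (-B) * (B - 1 / 2) :=
    calc (0.0365 * 2.807 : ℝ) ≤ exp (-(1 * 3.307)) * (-(1 / 2) + 1 * 3.307) := by
          norm_num at hexp ⊢; linarith
      _ ≤ exp (-(1 * B)) * (-(1 / 2) + 1 * B) :=
          exp_neg_mul_affine_le hB' (by linarith) (by linarith)
      _ = exp (-B) * (B - 1 / 2) := by ring_nf
  linarith [tsum_kernel_zero_succ_le hA (by linarith : 1 / 2 ≤ B)]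

theorem le_tsum_kernel {A B : ℝ} (hA : 5.1 ≤ A) (hAB : A ≤ B) (hB : B ≤ A + 1) (x : ℝ) :
    0.4998 ≤ ∑' p : ℤ × ℤ, kernel A B p * cos (2 * π * (p.1 * p.2) * x) := by
  have haxes := tsum_kernel_axes_nonneg (by linarith : 0 < A) hAB
  have hsum := (abs_le.mp (abs_tsum_coeff_mul_le (by linarith) hAB hB
    fun q => abs_cos_le_one (2 * π * freq q * x))).2
  have hexp : exp (-(A + B)) ≤ 1 / 20000 := exp_neg_le (x := 10.2) 30 (by norm_num)
    (by norm_num) (by linarith) (by norm_num [Finset.sum_range_succ, Nat.factorial])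
  rw [tsum_kernel_eq (by linarith) (by linarith), ← neg_add']
  linarith [mul_le_mul_of_nonneg_left hsum (exp_nonneg (-(A + B)))]

theorem tsum_kernel_le {A B : ℝ} (hA : 2.984 ≤ A) (hB : 3.12 ≤ B) (hB' : B ≤ 3.307)
    (hAB : A ≤ B) (x : ℝ) :
    ∑' p : ℤ × ℤ, kernel A B p * cos (2 * π * (p.1 * p.2) * x) ≤ 0.66 := by
  have hcol := tsum_kernel_succ_zero_le_of_ge hA (by linarith) (by linarith : 0 < B)
  have hrow := tsum_kernel_zero_succ_le_of_le (by linarith : 0 < A) (by linarith) hB'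
  have hsum := (abs_le.mp (abs_tsum_coeff_mul_le (by linarith) hAB (by linarith)
    fun q => abs_cos_le_one (2 * π * freq q * x))).1
  have hexp : exp (-(A + B)) ≤ 1 / 440 := exp_neg_le (x := 6.1) 24 (by norm_num)
    (by norm_num) (by linarith) (by norm_num [Finset.sum_range_succ, Nat.factorial])
  rw [tsum_kernel_eq (by linarith) (by linarith), ← neg_add']
  linarith [mul_le_mul_of_nonneg_left hsum (exp_nonneg (-(A + B)))]

theorem energy_zero_one_le {α x y : ℝ} (hα : 0.95 ≤ α) (hα₁ : α ≤ 1) (hy : 1.75 ≤ y)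
    (hδ : π * y / α - π * α * y ≤ 1) : energy α 0 1 ≤ energy α x y := by
  have hπ := pi_gt_d4
  have hπ' := pi_lt_d4
  have hα₀ : 0 < α := by linarith
  have hAB {t : ℝ} (ht : 0 ≤ t) : π * α * t ≤ π * t / α := by
    have := mul_nonneg (pi_div_sub_nonneg hα₀ hα₁) ht
    rw [mul_div_right_comm]
    linarith
  have hA : 5.1 ≤ π * α * y :=
    calc (5.1 : ℝ) ≤ 3.1415 * 0.95 * 1.75 := by norm_num
      _ ≤ π * α * y := by gcongr
  have hhigh := le_tsum_kernel hA (hAB (by linarith)) (by linarith) x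
  have hlow := tsum_kernel_le (A := π * α * 1) (B := π * 1 / α) (by nlinarith)
    (by rw [le_div_iff₀ hα₀]; nlinarith) (by rw [div_le_iff₀ hα₀]; nlinarith)
    (hAB zero_le_one) 0
  have hsqrt : √(y / α) = √y * √(1 / α) := by rw [← sqrt_mul (by linarith), mul_one_div]
  have hy' : 1.3228 ≤ √y := le_sqrt_of_sq_le (by norm_num at hy ⊢; linarith)
  rw [energy_eq_tsum_kernel hα₀ one_pos, energy_eq_tsum_kernel hα₀ (by linarith : 0 < y), hsqrt]
  calc _ ≤ √(1 / α) / (π * α) * 0.66 := by gcongr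
    _ ≤ √(1 / α) / (π * α) * (1.3228 * 0.4998) := by gcongr; norm_num
    _ ≤ √(1 / α) / (π * α) * (√y * ∑' p : ℤ × ℤ,
          kernel (π * α * y) (π * y / α) p * cos (2 * π * (p.1 * p.2) * x)) := by gcongr
    _ = _ := by ring

/-! ### Reduction to the curve `Γ` -/

/-- The point `x + i y` lies on the curve `Γ`, in real coordinates; the arc `Γ_b` is described by
algebraic conditions instead of its angle. -/
def OnGamma (x y : ℝ) : Prop :=
  (x = 0 ∧ 1 ≤ y) ∨ (x ^ 2 + y ^ 2 = 1 ∧ 0 ≤ x ∧ x ≤ 1 / 2 ∧ 0 ≤ y)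

theorem exists_onGamma_of_re_zero {y : ℝ} (α : ℝ) (hy : 0 < y) :
    ∃ x' y', OnGamma x' y' ∧ energy α x' y' = energy α 0 y := by
  rcases le_total 1 y with h | h
  · exact ⟨0, y, .inl ⟨rfl, h⟩, rfl⟩
  · refine ⟨_, _, .inl ⟨by simp, ?_⟩, energy_inv α 0 hy.ne'⟩
    rw [le_div_iff₀ (by positivity)]
    nlinarith

theorem exists_onGamma_of_re_half {y : ℝ} (α : ℝ) (hy : 0 < y) (hl : 1 / 12 ≤ y ^ 2)
    (hu : y ^ 2 ≤ 3 / 4) : ∃ x' y', OnGamma x' y' ∧ energy α x' y' = energy α (1 / 2) y := by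
  have hd : 0 < y ^ 2 + 1 / 4 := by positivity
  have hinv := energy_inv α (1 / 2) hy.ne'
  have hre : (1 / 2 : ℝ) / ((1 / 2) ^ 2 + y ^ 2) = (1 / 4 - y ^ 2) / (y ^ 2 + 1 / 4) + 1 := by
    field
  have him : y / ((1 / 2) ^ 2 + y ^ 2) = y / (y ^ 2 + 1 / 4) := by ring_nf
  rw [hre, him, energy_add_one, ← energy_abs] at hinv
  refine ⟨_, _, .inr ⟨?_, abs_nonneg _, ?_, by positivity⟩, hinv⟩
  · rw [sq_abs]
    field
  · rw [abs_le, le_div_iff₀ hd, div_le_iff₀ hd]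
    constructor <;> linarith

theorem sqrt_three_half_le_im {x y : ℝ} (hx₀ : 0 ≤ x) (hx : x ≤ 1 / 2) (hy : 0 < y)
    (h : 1 ≤ x ^ 2 + y ^ 2) : √3 / 2 ≤ y := by
  refine le_of_sq_le_sq ?_ hy.le
  rw [sqrt_three_half_sq]
  nlinarith

theorem le_div_one_sub_sq_add_sq {l x y : ℝ} (hl₀ : 0 ≤ l) (hl : l ≤ 1 / 2) (hx₀ : 0 ≤ x)
    (hx : x ≤ 1 / 2) (hy : 0 < y) (h : 1 ≤ x ^ 2 + y ^ 2) (hly : 1 ≤ y → l * (1 + y ^ 2) ≤ y) :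
    l ≤ y / ((1 - x) ^ 2 + y ^ 2) := by
  rw [le_div_iff₀ (by positivity)]
  rcases le_total 1 y with hy₁ | hy₁
  · calc l * ((1 - x) ^ 2 + y ^ 2) ≤ l * (1 + y ^ 2) := by gcongr; nlinarith
      _ ≤ y := hly hy₁
  · have hxy : 1 - x ≤ y := by
      by_contra!
      nlinarith
    calc l * ((1 - x) ^ 2 + y ^ 2) ≤ 1 / 2 * (2 * y) := by gcongr; nlinarith
      _ = y := by ring

theorem div_one_sub_sq_add_sq_le {x y : ℝ} (hx : x ≤ 1 / 2) (hy : √3 / 2 ≤ y) :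
    y / ((1 - x) ^ 2 + y ^ 2) ≤ √3 / 2 := by
  have hl := le_sqrt_three_half
  have hfactor : 0 ≤ (y - √3 / 2) * (√3 / 2 * y - 1 / 4) :=
    mul_nonneg (sub_nonneg.mpr hy) (by nlinarith)
  have hy₀ : 0 < y := by linarith
  rw [div_le_iff₀ (by positivity)]
  calc y ≤ √3 / 2 * (1 / 4 + y ^ 2) := by
        linear_combination hfactor - y * sqrt_three_half_sq
    _ ≤ √3 / 2 * ((1 - x) ^ 2 + y ^ 2) := by gcongr; nlinarith

/-- The reflected inversion `1 / (1 - z)` of `x + i y` has height at most `√3 / 2`; moving it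
horizontally to the line `Re = 1 / 2` lowers the energy and leads back to the arc of `Γ`. -/
theorem exists_onGamma_of_slope_nonpos {α x y : ℝ} (l : ℝ) (hα : 0 < α) (hx₀ : 0 ≤ x)
    (hx : x ≤ 1 / 2) (hy : 0 < y) (h : 1 ≤ x ^ 2 + y ^ 2) (hl₀ : 3 / 10 ≤ l) (hl : l ≤ 1 / 2)
    (hly : 1 ≤ y → l * (1 + y ^ 2) ≤ y)
    (hslope : ∀ t a, l ≤ t → t ≤ √3 / 2 → cos a ≠ 1 → slope (π * α * t) (π * t / α) a 0 ≤ 0) :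
    ∃ x' y', OnGamma x' y' ∧ energy α x' y' ≤ energy α x y := by
  have hinv : energy α ((1 - x) / ((1 - x) ^ 2 + y ^ 2)) (y / ((1 - x) ^ 2 + y ^ 2)) =
      energy α x y := by rw [energy_inv α _ hy.ne', energy_one_sub]
  have hlow := le_div_one_sub_sq_add_sq (by linarith) hl hx₀ hx hy h hly
  have hhigh := div_one_sub_sq_add_sq_le hx (sqrt_three_half_le_im hx₀ hx hy h)
  set t := y / ((1 - x) ^ 2 + y ^ 2)
  have ht : 0 < t := by positivity
  have hhalf := energy_half_le (q := 1 / 2 - (1 - x) / ((1 - x) ^ 2 + y ^ 2)) hα ht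
    (hslope _ _ hlow hhigh)
  rw [sub_sub_cancel, hinv] at hhalf
  obtain ⟨x', y', hΓ, heq⟩ := exists_onGamma_of_re_half α ht (by nlinarith)
    (by rw [← sqrt_three_half_sq]; gcongr)
  exact ⟨x', y', hΓ, heq.trans_le hhalf⟩

theorem energy_le_of_critical {α x x' y : ℝ} (hα : 0.9 ≤ α) (hα' : α ≤ 0.918)
    (hhex : 0 ≤ harmonicSum (π * α * (√3 / 2)) (π / α * (√3 / 2)) fun k => (k : ℝ) ^ 2)
    (hx' : 0 ≤ x') (hxx' : x' ≤ x) (hx : x ≤ 1 / 2) (hy : √3 / 2 ≤ y) (hy' : y ≤ 1.01)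
    (h : 1 ≤ x' ^ 2 + y ^ 2) : energy α x' y ≤ energy α x y := by
  rcases hxx'.eq_or_lt with rfl | hlt
  · exact le_rfl
  have hcos : cos (2 * π * (1 / 2 - x')) < cos (2 * π * (1 / 2 - x)) := by
    apply cos_lt_cos_of_nonneg_of_le_pi <;> nlinarith [pi_pos]
  have hheight : 1 - cos (2 * π * (1 / 2 - x')) ≤ 8 * (y ^ 2 - 3 / 4) := by
    have hquad := cos_le_one_sub_mul_cos_sq (x := 2 * π * x') (by
      rw [abs_of_nonneg (by positivity)]; nlinarith [pi_pos])
    have hcancel : 2 / π ^ 2 * (2 * π * x') ^ 2 = 8 * x' ^ 2 := by field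
    rw [show 2 * π * (1 / 2 - x') = π - 2 * π * x' by ring, cos_pi_sub]
    linarith
  have hslope := slope_nonneg_of_critical (criticalPair hα hα') hhex hy hy' hcos hheight
  rw [div_mul_eq_mul_div] at hslope
  obtain ⟨C, hC, hsub⟩ := exists_pos_energy_half_sub (α := α) (y := y) (by linarith)
    (by linarith [le_sqrt_three_half]) (1 / 2 - x) (1 / 2 - x')
  rw [sub_sub_cancel, sub_sub_cancel] at hsub
  rw [← sub_nonneg, hsub]
  exact mul_nonneg hC.le (mul_nonneg (sub_nonneg.mpr hcos.le) hslope)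

theorem exists_onGamma_of_critical_of_nonneg {α x y : ℝ} (hα : 0.9 ≤ α) (hα' : α ≤ 0.918)
    (hhex : 0 ≤ harmonicSum (π * α * (√3 / 2)) (π / α * (√3 / 2)) fun k => (k : ℝ) ^ 2)
    (hx₀ : 0 ≤ x) (hx : x ≤ 1 / 2) (hy : √3 / 2 ≤ y) (hy' : y ≤ 1.01)
    (h : 1 ≤ x ^ 2 + y ^ 2) : ∃ x' y', OnGamma x' y' ∧ energy α x' y' ≤ energy α x y := by
  rcases le_total 1 y with hy₁ | hy₁
  · exact ⟨0, y, .inl ⟨rfl, hy₁⟩,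
      energy_le_of_critical hα hα' hhex le_rfl hx₀ hx hy hy' (by nlinarith)⟩
  · have hy₀ : 0 ≤ y := by linarith [le_sqrt_three_half]
    have hsq : √(1 - y ^ 2) ^ 2 = 1 - y ^ 2 := sq_sqrt (by nlinarith)
    have hle : √(1 - y ^ 2) ≤ x := sqrt_le_iff.mpr ⟨hx₀, by linarith⟩
    have harc : √(1 - y ^ 2) ^ 2 + y ^ 2 = 1 := by linarith
    exact ⟨√(1 - y ^ 2), y, .inr ⟨harc, sqrt_nonneg _, hle.trans hx, hy₀⟩,
      energy_le_of_critical hα hα' hhex (sqrt_nonneg _) hle hx hy hy' harc.ge⟩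

theorem exists_onGamma_of_critical {α x y : ℝ} (hα : 0.9 ≤ α) (hα' : α ≤ 0.918) (hx₀ : 0 ≤ x)
    (hx : x ≤ 1 / 2) (hy : √3 / 2 ≤ y) (hy' : y ≤ 1.01) (h : 1 ≤ x ^ 2 + y ^ 2) :
    ∃ x' y', OnGamma x' y' ∧ energy α x' y' ≤ energy α x y := by
  rcases le_total 0 (harmonicSum (π * α * (√3 / 2)) (π / α * (√3 / 2)) fun k => (k : ℝ) ^ 2)
    with hhex | hhex
  · exact exists_onGamma_of_critical_of_nonneg hα hα' hhex hx₀ hx hy hy' h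
  have hpair := criticalPair hα hα'
  refine exists_onGamma_of_slope_nonpos 0.499 (by linarith) hx₀ hx
    (by linarith [le_sqrt_three_half]) h (by norm_num) (by norm_num) (fun _ => by nlinarith) ?_
  intro t a hl hu ha
  rcases le_total t 0.8 with ht | ht
  · exact slope_zero_nonpos_of_gap_le hα (by linarith) (gap_le_of_harmonicSum_nonpos hpair hhex)
      hl ht ha
  · have := slope_zero_nonpos_of_critical hpair hhex ht hu ha
    rwa [div_mul_eq_mul_div] at this

theorem exists_onGamma_of_im_le {α x y : ℝ} (hα : 0.918 ≤ α) (hα₁ : α ≤ 1) (hx₀ : 0 ≤ x)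
    (hx : x ≤ 1 / 2) (hy : 0 < y) (hy' : y ≤ 1.3) (h : 1 ≤ x ^ 2 + y ^ 2) :
    ∃ x' y', OnGamma x' y' ∧ energy α x' y' ≤ energy α x y :=
  exists_onGamma_of_slope_nonpos 0.48 (by linarith) hx₀ hx hy h (by norm_num) (by norm_num)
    (fun _ => by nlinarith) fun _ _ hl hu ha =>
      slope_zero_nonpos_of_large_parameter hα hα₁ hl (hu.trans sqrt_three_half_le) ha

theorem exists_onGamma_of_near_one {α x y : ℝ} (hα : 0.936 ≤ α) (hα₁ : α ≤ 1) (hx₀ : 0 ≤ x)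
    (hx : x ≤ 1 / 2) (hy : 0 < y) (hy' : y ≤ 1.75) (h : 1 ≤ x ^ 2 + y ^ 2) :
    ∃ x' y', OnGamma x' y' ∧ energy α x' y' ≤ energy α x y := by
  refine exists_onGamma_of_slope_nonpos 0.43 (by linarith) hx₀ hx hy h (by norm_num)
    (by norm_num) (fun _ => by nlinarith) fun t _ hl hu ha => ?_
  rcases le_total t 0.49 with ht | ht
  · exact slope_zero_nonpos_of_near_one hα hα₁ hl ht ha
  · exact slope_zero_nonpos_of_large_parameter (by linarith) hα₁ (by linarith)
      (hu.trans sqrt_three_half_le) ha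

theorem lt_of_pi_div_sub_mul_lt {α α₀ y y₀ : ℝ} (hα : 0 < α) (hα₁ : α ≤ 1) (hα₀ : α₀ ≤ 1)
    (hy₀ : 0 ≤ y₀) (hy : y₀ ≤ y) (h : (π / α - π * α) * y < 3.1415 * (1 / α₀ - α₀) * y₀) :
    α₀ < α := by
  by_contra! hle
  refine h.not_ge ?_
  have := pi_div_sub_nonneg hα hα₁
  gcongr
  exact pi_div_sub_ge hα hle hα₀

theorem exists_onGamma_le {α x y : ℝ} (hα : 0 < α) (hα₁ : α ≤ 1) (hx₀ : 0 ≤ x) (hx : x ≤ 1 / 2)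
    (hy₀ : 0 < y) (h : 1 ≤ x ^ 2 + y ^ 2) :
    ∃ x' y', OnGamma x' y' ∧ energy α x' y' ≤ energy α x y := by
  have hy := sqrt_three_half_le_im hx₀ hx hy₀ h
  have hgap : π * y / α - π * α * y = (π / α - π * α) * y := by ring
  rcases le_or_gt 0.54 ((π / α - π * α) * y) with hδ | hδ
  · obtain ⟨x', y', hΓ, heq⟩ := exists_onGamma_of_re_zero α hy₀
    exact ⟨x', y', hΓ, heq.trans_le (energy_zero_le hα hα₁ hy₀ (by nlinarith) (hgap ▸ hδ) x)⟩
  have hbound (α₀ y₀ : ℝ) (hα₀ : α₀ ≤ 1) (hy₀ : 0 ≤ y₀) (hy : y₀ ≤ y)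
      (hle : 0.54 ≤ 3.1415 * (1 / α₀ - α₀) * y₀) : α₀ ≤ α :=
    (lt_of_pi_div_sub_mul_lt hα hα₁ hα₀ hy₀ hy (hδ.trans_le hle)).le
  have hα₉ : 0.9 ≤ α := hbound 0.9 0.866 (by norm_num) (by norm_num)
    (le_sqrt_three_half.trans hy) (by norm_num)
  rcases le_total α 0.918 with hcrit | hlarge
  · refine exists_onGamma_of_critical hα₉ hcrit hx₀ hx hy ?_ h
    by_contra!
    nlinarith [(criticalPair hα₉ hcrit).gap]
  rcases le_total y 1.3 with hlow | hmid
  · exact exists_onGamma_of_im_le hlarge hα₁ hx₀ hx hy₀ hlow h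
  rcases le_total y 1.75 with hmid' | hhigh
  · exact exists_onGamma_of_near_one
      (hbound 0.936 1.3 (by norm_num) (by norm_num) hmid (by norm_num)) hα₁ hx₀ hx hy₀ hmid' h
  · refine ⟨0, 1, .inl ⟨rfl, le_rfl⟩, energy_zero_one_le
      (hbound 0.95 1.75 (by norm_num) (by norm_num) hhigh (by norm_num)) hα₁ hhigh ?_⟩
    linarith

/-! ### Existence of a minimizer -/

theorem OnGamma.im_pos {x y : ℝ} (h : OnGamma x y) : 0 < y := by
  rcases h with ⟨-, h⟩ | ⟨h, hx₀, hx, hy⟩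
  · linarith
  · by_contra!
    nlinarith

theorem OnGamma.re_mem_Icc {x y : ℝ} (h : OnGamma x y) : x ∈ Set.Icc 0 (1 / 2) := by
  rcases h with ⟨rfl, -⟩ | ⟨-, hx₀, hx, -⟩
  · norm_num
  · exact ⟨hx₀, hx⟩

theorem OnGamma.one_le_sq_add_sq {x y : ℝ} (h : OnGamma x y) : 1 ≤ x ^ 2 + y ^ 2 := by
  rcases h with ⟨rfl, hy⟩ | ⟨h, -⟩
  · nlinarith
  · exact h.ge

theorem energy_term_nonneg {y : ℝ} (α x : ℝ) (hy : 0 < y) (p : ℤ × ℤ) :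
    0 ≤ quadForm x y p * exp (-π * α * quadForm x y p) :=
  mul_nonneg (quadForm_nonneg x hy p) (exp_pos _).le

theorem energy_nonneg {y : ℝ} (α x : ℝ) (hy : 0 < y) : 0 ≤ energy α x y :=
  tsum_nonneg (energy_term_nonneg α x hy)

theorem exp_neg_mul_le_mul_exp_neg_mul {a s S : ℝ} (ha : 0 ≤ a) (hs : 1 ≤ s) (hS : s ≤ S) :
    exp (-a * S) ≤ s * exp (-a * s) :=
  calc exp (-a * S) ≤ exp (-a * s) :=
        exp_le_exp.mpr (mul_le_mul_of_nonpos_left hS (neg_nonpos.mpr ha))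
    _ ≤ s * exp (-a * s) := le_mul_of_one_le_left (exp_pos _).le hs

theorem exp_le_energy_term {α y : ℝ} {n : ℤ} (hα : 0 < α) (hy : 0 < y) (hl : √y ≤ n)
    (hu : n ≤ 4 * √y) :
    exp (-π * α * 16) ≤ quadForm 0 y (0, n) * exp (-π * α * quadForm 0 y (0, n)) := by
  have hsq : √y ^ 2 = y := sq_sqrt hy.le
  have hform : quadForm 0 y (0, n) = (n : ℝ) ^ 2 / y := by simp [quadForm]
  rw [hform, neg_mul]
  refine exp_neg_mul_le_mul_exp_neg_mul (by positivity) ?_ ?_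
  · rw [le_div_iff₀ hy, one_mul]
    calc y = √y ^ 2 := hsq.symm
      _ ≤ (n : ℝ) ^ 2 := by gcongr
  · rw [div_le_iff₀ hy]
    calc (n : ℝ) ^ 2 ≤ (4 * √y) ^ 2 :=
          pow_le_pow_left₀ ((sqrt_nonneg y).trans hl) hu 2
      _ = 16 * y := by rw [mul_pow, hsq]; norm_num

/-- The `⌈√y⌉` lattice vectors `(0, n)` with `⌈√y⌉ ≤ n < 2 ⌈√y⌉` have squared length between `1`
and `16`. -/
theorem sqrt_mul_exp_le_energy {α y : ℝ} (hα : 0 < α) (hy : 1 ≤ y) :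
    √y * exp (-π * α * 16) ≤ energy α 0 y := by
  have hy₀ : 0 < y := by linarith
  set N := ⌈√y⌉
  have hN : √y ≤ N := Int.le_ceil _
  have hN' : (N : ℝ) ≤ 2 * √y := by linarith [Int.ceil_lt_add_one √y, one_le_sqrt.mpr hy]
  have hterm : ∀ p ∈ ({0} ×ˢ Finset.Ico N (2 * N) : Finset (ℤ × ℤ)), exp (-π * α * 16) ≤
      quadForm 0 y p * exp (-π * α * quadForm 0 y p) := by
    rintro ⟨m, n⟩ hp
    simp only [Finset.mem_product, Finset.mem_singleton, Finset.mem_Ico] at hp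
    obtain ⟨rfl, hl, hu⟩ := hp
    have hl' : (N : ℝ) ≤ n := mod_cast hl
    have hu' : (n : ℝ) ≤ 2 * N := mod_cast hu.le
    exact exp_le_energy_term hα hy₀ (by linarith) (by linarith)
  have hcard : √y ≤ ({0} ×ˢ Finset.Ico N (2 * N) : Finset (ℤ × ℤ)).card := by
    rw [Finset.card_product, Finset.card_singleton, Int.card_Ico, two_mul, add_sub_cancel_right,
      one_mul]
    exact hN.trans (mod_cast Int.self_le_toNat N)
  calc √y * exp (-π * α * 16)
      ≤ ({0} ×ˢ Finset.Ico N (2 * N) : Finset (ℤ × ℤ)).card • exp (-π * α * 16) := by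
        rw [nsmul_eq_mul]
        gcongr
    _ ≤ ∑ p ∈ ({0} ×ˢ Finset.Ico N (2 * N) : Finset (ℤ × ℤ)),
          quadForm 0 y p * exp (-π * α * quadForm 0 y p) :=
        Finset.card_nsmul_le_sum _ _ _ hterm
    _ ≤ energy α 0 y :=
        (summable_energy 0 hα hy₀).sum_le_tsum _ fun p _ => energy_term_nonneg α 0 hy₀ p

theorem lowerSemicontinuousOn_energy {α : ℝ} (hα : 0 < α) :
    LowerSemicontinuousOn (fun p : ℝ × ℝ => ENNReal.ofReal (energy α p.1 p.2)) {p | 0 < p.2} := by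
  have htsum : LowerSemicontinuousOn (fun p : ℝ × ℝ => ∑' q : ℤ × ℤ, ENNReal.ofReal
      (quadForm p.1 p.2 q * exp (-π * α * quadForm p.1 p.2 q))) {p | 0 < p.2} := by
    refine lowerSemicontinuousOn_tsum fun q => ContinuousOn.lowerSemicontinuousOn ?_
    have hq : ContinuousOn (fun p : ℝ × ℝ => quadForm p.1 p.2 q) {p | 0 < p.2} :=
      ContinuousOn.div (by fun_prop) (by fun_prop) fun p hp => ne_of_gt hp
    exact ENNReal.continuous_ofReal.comp_continuousOn
      (hq.mul (continuous_exp.comp_continuousOn (continuousOn_const.mul hq)))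
  exact fun p hp => LowerSemicontinuousWithinAt.congr_of_eventuallyEq (htsum p hp) hp <|
    Filter.Eventually.mono self_mem_nhdsWithin fun p' hp' =>
      (ENNReal.ofReal_tsum_of_nonneg (energy_term_nonneg α p'.1 hp')
        (summable_energy p'.1 hα hp')).symm

theorem isClosed_onGamma : IsClosed {p : ℝ × ℝ | OnGamma p.1 p.2} := by
  have hline : IsClosed {p : ℝ × ℝ | p.1 = 0 ∧ 1 ≤ p.2} :=
    (isClosed_eq continuous_fst continuous_const).inter
      (isClosed_le continuous_const continuous_snd)
  have hcircle : IsClosed {p : ℝ × ℝ | p.1 ^ 2 + p.2 ^ 2 = 1} :=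
    isClosed_eq (by fun_prop) continuous_const
  exact hline.union <| hcircle.inter <| (isClosed_le continuous_const continuous_fst).inter <|
    (isClosed_le continuous_fst continuous_const).inter
      (isClosed_le continuous_const continuous_snd)

theorem isCompact_onGamma_im_le (R : ℝ) : IsCompact {p : ℝ × ℝ | OnGamma p.1 p.2 ∧ p.2 ≤ R} := by
  refine Metric.isCompact_of_isClosed_isBounded
    (isClosed_onGamma.inter (isClosed_le continuous_snd continuous_const))
    ((Metric.isBounded_Icc (0 : ℝ × ℝ) (1 / 2, R)).subset ?_)
  rintro ⟨x, y⟩ ⟨hΓ, hR⟩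
  exact ⟨⟨hΓ.re_mem_Icc.1, hΓ.im_pos.le⟩, ⟨hΓ.re_mem_Icc.2, hR⟩⟩

theorem energy_zero_one_le_of_onGamma {α x y : ℝ} (hα : 0 < α) (hΓ : OnGamma x y) (hy : 1 < y)
    (hlarge : (energy α 0 1 * exp (π * α * 16)) ^ 2 ≤ y) : energy α 0 1 ≤ energy α x y := by
  have hx : x = 0 := by
    rcases hΓ with ⟨hx, -⟩ | ⟨h, -⟩
    · exact hx
    · nlinarith
  subst hx
  calc energy α 0 1 = energy α 0 1 * exp (π * α * 16) * exp (-π * α * 16) := by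
        rw [mul_assoc, ← exp_add]
        ring_nf
        simp
    _ ≤ √y * exp (-π * α * 16) := by
        gcongr
        exact le_sqrt_of_sq_le hlarge
    _ ≤ energy α 0 y := sqrt_mul_exp_le_energy hα hy.le

theorem exists_min_onGamma {α : ℝ} (hα : 0 < α) :
    ∃ x₀ y₀, OnGamma x₀ y₀ ∧ ∀ x y, OnGamma x y → energy α x₀ y₀ ≤ energy α x y := by
  set R := max 1 ((energy α 0 1 * exp (π * α * 16)) ^ 2)
  have hI : OnGamma 0 1 := .inl ⟨rfl, le_rfl⟩
  have hIR : (1 : ℝ) ≤ R := le_max_left _ _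
  have hmem : ((0, 1) : ℝ × ℝ) ∈ {p : ℝ × ℝ | OnGamma p.1 p.2 ∧ p.2 ≤ R} := ⟨hI, hIR⟩
  obtain ⟨⟨x₀, y₀⟩, ⟨hΓ₀, -⟩, hmin⟩ := LowerSemicontinuousOn.exists_isMinOn
    ⟨_, hmem⟩ (isCompact_onGamma_im_le R)
    ((lowerSemicontinuousOn_energy hα).mono fun p hp => hp.1.im_pos)
  have hle (x y : ℝ) (hΓ : OnGamma x y) (hy : y ≤ R) : energy α x₀ y₀ ≤ energy α x y :=
    (ENNReal.ofReal_le_ofReal_iff (energy_nonneg α x hΓ.im_pos)).mp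
      (isMinOn_iff.mp hmin (x, y) ⟨hΓ, hy⟩)
  refine ⟨x₀, y₀, hΓ₀, fun x y hΓ => ?_⟩
  rcases le_or_gt y R with hy | hy
  · exact hle x y hΓ hy
  · exact (hle 0 1 hI hIR).trans (energy_zero_one_le_of_onGamma hα hΓ (hIR.trans_lt hy)
      ((le_max_right _ _).trans hy.le))

theorem mem_GammaA_iff (z : ℍ) : z ∈ GammaA ↔ z.re = 0 ∧ 1 ≤ z.im := by
  constructor
  · rintro ⟨y, hy, h⟩
    rw [← coe_re, ← coe_im, h]
    simpa using hy
  · rintro ⟨hre, him⟩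
    exact ⟨z.im, him, Complex.ext (by simp [hre]) (by simp)⟩

theorem mem_GammaB_iff (z : ℍ) :
    z ∈ GammaB ↔ z.re ^ 2 + z.im ^ 2 = 1 ∧ 0 ≤ z.re ∧ z.re ≤ 1 / 2 ∧ 0 ≤ z.im := by
  constructor
  · rintro ⟨t, ⟨hl, hu⟩, h⟩
    rw [mul_comm] at h
    have hre : z.re = cos t := by rw [← coe_re, h, Complex.exp_ofReal_mul_I_re]
    have him : z.im = sin t := by rw [← coe_im, h, Complex.exp_ofReal_mul_I_im]
    have hπ := pi_pos
    refine ⟨?_, ?_, ?_, z.im_pos.le⟩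
    · rw [hre, him, cos_sq_add_sin_sq]
    · rw [hre]
      exact cos_nonneg_of_mem_Icc ⟨by linarith, hu⟩
    · rw [hre, ← cos_pi_div_three]
      exact cos_le_cos_of_nonneg_of_le_pi (by linarith) (by linarith) hl
  · rintro ⟨h, hre₀, hre, him⟩
    have hthird : arccos (1 / 2) = π / 3 := by
      rw [← cos_pi_div_three, arccos_cos (by positivity) (by linarith [pi_pos])]
    refine ⟨arccos z.re, ⟨?_, ?_⟩, ?_⟩
    · rw [← hthird]
      exact arccos_le_arccos hre
    · rw [← arccos_zero]
      exact arccos_le_arccos hre₀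
    · rw [mul_comm]
      apply Complex.ext
      · rw [Complex.exp_ofReal_mul_I_re, cos_arccos (by linarith) (by linarith), coe_re]
      · rw [Complex.exp_ofReal_mul_I_im, sin_arccos, ← h, add_sub_cancel_left, sqrt_sq him, coe_im]

theorem mem_Gamma_iff (z : ℍ) : z ∈ Gamma ↔ OnGamma z.re z.im :=
  or_congr (mem_GammaA_iff z) (mem_GammaB_iff z)

theorem one_lt_norm_of_perturbation {x y ε : ℝ} (hx₀ : 0 ≤ x) (hx : x ≤ 1 / 2) (hy : 0 < y)
    (h : 1 ≤ x ^ 2 + y ^ 2) (hε : 0 < ε) :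
    1 < ‖(⟨x + ε * (1 / 4 - x), y + ε⟩ : ℂ)‖ := by
  rw [Complex.norm_def, Complex.normSq_apply]
  refine lt_sqrt_of_sq_lt ?_
  have hy' : 1 / 2 ≤ y := by nlinarith
  nlinarith [mul_pos hε (by nlinarith : 0 < y + x * (1 / 4 - x)),
    sq_nonneg (ε * (1 / 4 - x)), sq_nonneg ε]

theorem mem_closure_halfDomain {z : ℍ} (hre : z.re ∈ Set.Icc 0 (1 / 2))
    (h : 1 ≤ z.re ^ 2 + z.im ^ 2) : z ∈ closure halfDomain := by
  obtain ⟨hre₀, hre₁⟩ := hre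
  rw [isEmbedding_coe.isInducing.closure_eq_preimage_closure_image, Set.mem_preimage]
  let γ : ℝ → ℂ := fun ε => ⟨z.re + ε * (1 / 4 - z.re), z.im + ε⟩
  have hγ : Continuous γ := by
    simp only [γ, Complex.mk_eq_add_mul_I]
    fun_prop
  have hγ₀ : γ 0 = z := by apply Complex.ext <;> simp [γ]
  have htendsto : Filter.Tendsto γ (nhdsWithin 0 (Set.Ioi 0)) (nhds (z : ℂ)) :=
    hγ₀ ▸ (hγ.tendsto 0).mono_left nhdsWithin_le_nhds
  refine mem_closure_of_tendsto htendsto ?_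
  filter_upwards [Ioo_mem_nhdsGT one_pos] with ε ⟨hε₀, hε₁⟩
  refine ⟨⟨γ ε, add_pos z.im_pos hε₀⟩,
    ⟨one_lt_norm_of_perturbation hre₀ hre₁ z.im_pos h hε₀, ?_, ?_⟩, rfl⟩
  · change 0 < z.re + ε * (1 / 4 - z.re)
    nlinarith
  · change z.re + ε * (1 / 4 - z.re) < 1 / 2
    nlinarith

theorem Gamma_subset_closure_halfDomain : Gamma ⊆ closure halfDomain := fun z hz =>
  have hΓ := (mem_Gamma_iff z).mp hz
  mem_closure_halfDomain hΓ.re_mem_Icc hΓ.one_le_sq_add_sq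

theorem exists_mem_Gamma_forall_M_le {α : ℝ} (hα : 0 < α) (hα₁ : α ≤ 1) :
    ∃ z₀ ∈ Gamma, ∀ z : ℍ, M α z₀ ≤ M α z := by
  obtain ⟨x₀, y₀, hΓ₀, hmin⟩ := exists_min_onGamma hα
  refine ⟨⟨⟨x₀, y₀⟩, hΓ₀.im_pos⟩, (mem_Gamma_iff _).mpr hΓ₀, fun z => ?_⟩
  obtain ⟨g, hnorm, hre⟩ := ModularGroup.exists_smul_mem_fd z
  have hsq : 1 ≤ |(g • z).re| ^ 2 + (g • z).im ^ 2 := by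
    simpa [Complex.normSq_apply, ← sq] using hnorm
  obtain ⟨x, y, hΓ, hle⟩ := exists_onGamma_le hα hα₁ (abs_nonneg _) hre (g • z).im_pos hsq
  rw [← M_smul α g z, M_eq_energy, M_eq_energy, ← energy_abs α (g • z).re]
  exact (hmin x y hΓ).trans hle

end LatticeEnergy

/-- For `0 < α ≤ 1` the series defining `M(α, ·)` converges on `ℍ`, and the minima of `M(α, ·)` over
`ℍ`, over the closed half fundamental domain and over `Γ` are all attained and equal. -/
theorem theorem4p1 (α : ℝ) (hα : α ∈ Set.Ioc (0 : ℝ) 1) :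
    (∀ z : UpperHalfPlane, Summable fun p : ℤ × ℤ =>
      LatticeEnergy.normSqPt z p * Real.exp (-Real.pi * α * LatticeEnergy.normSqPt z p)) ∧
    ∃ v : ℝ,
      IsLeast (Set.range (LatticeEnergy.M α)) v ∧
      IsLeast (LatticeEnergy.M α '' closure LatticeEnergy.halfDomain) v ∧
      IsLeast (LatticeEnergy.M α '' LatticeEnergy.Gamma) v := by
  refine ⟨fun z => ?_, ?_⟩
  · simp_rw [LatticeEnergy.normSqPt_eq_quadForm]
    exact LatticeEnergy.summable_energy z.re hα.1 z.im_pos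
  · obtain ⟨z₀, hz₀, hmin⟩ := LatticeEnergy.exists_mem_Gamma_forall_M_le hα.1 hα.2
    have hlower (s : Set ℍ) :
        LatticeEnergy.M α z₀ ∈ lowerBounds (LatticeEnergy.M α '' s) := by
      rintro _ ⟨z, -, rfl⟩
      exact hmin z
    refine ⟨LatticeEnergy.M α z₀, ⟨⟨z₀, rfl⟩, ?_⟩,
      ⟨⟨z₀, LatticeEnergy.Gamma_subset_closure_halfDomain hz₀, rfl⟩, hlower _⟩,
      ⟨⟨z₀, hz₀, rfl⟩, hlower _⟩⟩
    rintro _ ⟨z, rfl⟩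
    exact hmin z
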